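/- **Proposition (Source-Seeking & Obstacle Avoidance).** Let $p_0=(p_{0,1},p_{0,2})\in\mathbb{R}^2$ and $r>0$ (the obstacle is contained in the closed ball of radius $r$ centred at $p_0$). Put $$\mathcal{L}_1:=\{p: p_2<-p_1+p_{0,2}+p_{0,1}-2r\sqrt2\}\cup\{p: p_2<p_1+p_{0,2}-p_{0,1}-2r\sqrt2\},$$ $$\mathcal{L}_2:=\{p: p_2>p_1+p_{0,2}-p_{0,1}+2r\sqrt2\}\cup\{p: p_2>-p_1+p_{0,2}+p_{0,1}+2r\sqrt2\},$$ and $\mathcal{U}:=\mathcal{L}_1\cup\mathcal{L}_2=\mathbb{R}^2\setminus\{p:\|p-p_0\|_1\le 2r\sqrt2\}$, and let $\mathcal{Q}:=\{1,2\}\subset\mathbb{R}$. Let $J:\mathbb{R}^2\to\mathbb{R}$ have $u^\star$ as its unique maximizer on $\overline{\mathcal{U}}$. Given barrier functions $B_q$, let $\hat J_q:=-J+B_q$ on $\mathcal{L}_q$ and $\hat J_q:=\infty$ on $\mathbb{R}^2\setminus\mathcal{L}_q$, and let $W(\hat u,q):=\hat J_q(\hat u)+J(u^\star)$. Assume: 1.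 for each $q\in\mathcal{Q}$, $\hat J_q$ takes values in $[0,\infty]$, is continuously differentiable in $\mathcal{L}_q$, and tends to $\infty$ as $|\hat u|\to\infty$ and as $\hat u$ tends to a boundary point of $\mathcal{L}_q$; 2. there are $\alpha_1,\alpha_2\in\mathcal{K}_\infty$ and a proper indicator $\varpi$ of $\{u^\star\}$ on $\mathcal{U}$ with $\alpha_1(\varpi(\hat u))\le\min_{s\in\mathcal{Q}}W(\hat u,s)\le\alpha_2(\varpi(\hat u))$ for all $\hat u\in\mathcal{U}$; 3. there is a positive definite function $\varrho$ with $|\nabla\hat J_q(\hat u)|^2\ge\varrho(W(\hat u,q))$ for all $q\in\mathcal{Q}$ and $\hat u\in\mathcal{L}_q$. Here a *proper indicator* of a set $A\subseteq S$ on $S$ is a function $S\to[0,\infty)$ that is continuous, vanishes exactly on $A$, and tends to $\infty$ as its argument in $S$ tends to infinity or to a point of $\overline{S}\setminus S$. Let $\chi>1$ and $\lambda\in(0,\chi-1)$. Consider the hybrid decision-making dynamics with state $(\hat u,q)\in\mathbb{R}^2\times\mathbb{R}$, input $\xi\in\mathbb{R}^2$, and $$C:=\{(\hat u,q)\in\overline{\mathcal{U}}\times\mathcal{Q}:\hat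 J_q(\hat u)\le\chi\hat J_{3-q}(\hat u)\},\qquad \dot{\hat u}=-\xi,\ \dot q=0,$$ $$D:=\{(\hat u,q)\in\overline{\mathcal{U}}\times\mathcal{Q}:\hat J_q(\hat u)\ge(\chi-\lambda)\hat J_{3-q}(\hat u)\},\qquad \hat u^+=\hat u,\ q^+=3-q.$$ Then: (a) $C$ and $D$ are closed and their projections on the $\hat u$-component are contained in $\overline{\mathcal{U}}$; the flow map $(\hat u,q,\xi)\mapsto\{(-\xi,0)\}$ is outer semicontinuous, locally bounded and convex-valued relative to $C\times\mathbb{R}^2$; and the jump map $(\hat u,q)\mapsto\{(\hat u,3-q)\}$ is outer semicontinuous and locally bounded relative to $D$. (b) For the target hybrid system obtained with $\xi:=\nabla\hat J_q(\hat u)$ (no flow is possible where $\hat J_q$ is not finite and differentiable), the compact set $\mathcal{A}:=\{u^\star\}\times\mathcal{Q}$ is uniformly asymptotically stable with basin of attraction $\mathcal{U}\times\mathcal{Q}$. That is: $\mathcal{A}\subset\mathcal{U}\times\mathcal{Q}$, and $\mathcal{U}\times\mathcal{Q}$ is relatively open in $C\cup D$; every solution that starts in $\mathcal{U}\times\mathcal{Q}$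 stays in $\mathcal{U}\times\mathcal{Q}$; for every proper indicator $\omega$ of $\mathcal{A}$ on $\mathcal{U}\times\mathcal{Q}$ there is a class-$\mathcal{KL}$ function $\beta$ such that every solution $x$ with $x(0,0)\in\mathcal{U}\times\mathcal{Q}$ satisfies $\omega(x(t,j))\le\beta(\omega(x(0,0)),t+j)$ for all $(t,j)\in\mathrm{dom}(x)$; and $\mathcal{U}\times\mathcal{Q}$ is exactly the set of points of $C\cup D$ from which every solution is bounded and, if it is complete, converges to $\mathcal{A}$. -/

import Mathlib

open Set Filter Topology MeasureTheory
open scoped NNReal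

noncomputable section

/-! ### Comparison functions and proper indicators -/

/-- Class `𝒦_∞`. -/
structure IsClassKInf (α : ℝ≥0 → ℝ≥0) : Prop where
  map_zero : α 0 = 0
  continuous : Continuous α
  strictMono : StrictMono α
  unbounded : Tendsto α atTop atTop

/-- Class `𝒦ℒ`. -/
structure IsClassKL (β : ℝ≥0 → ℝ≥0 → ℝ≥0) : Prop where
  mono_left : ∀ s, Monotone fun r => β r s
  anti_right : ∀ r, Antitone (β r)
  tendsto_left : ∀ s, Tendsto (fun r => β r s) (𝓝[>] 0) (𝓝 0)
  tendsto_right : ∀ r, Tendsto (β r) atTop (𝓝 0)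

/-- Positive definite function of a nonnegative argument (only values on `[0, ∞)` matter). -/
def IsPosDefFun (ϱ : ℝ → ℝ) : Prop :=
  ϱ 0 = 0 ∧ ∀ s, 0 < s → 0 < ϱ s

/-- `ω` is a proper indicator of `A` on `S`: it is continuous on `S`, vanishes exactly on `A ⊆ S`,
and tends to infinity as the point of `S` tends to infinity or to a boundary point of `S` outside
`S` (for an open set `S` these are all boundary points of `S`). -/
structure IsProperIndicator {X : Type*} [TopologicalSpace X]
    (ω : X → ℝ≥0) (A S : Set X) : Prop where
  subset : A ⊆ S
  continuousOn : ContinuousOn ω S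
  eq_zero_iff : ∀ x ∈ S, (ω x = 0 ↔ x ∈ A)
  tendsto_infty : Tendsto ω (cocompact X ⊓ 𝓟 S) atTop
  tendsto_boundary : ∀ z ∈ closure S \ S, Tendsto ω (𝓝[S] z) atTop

/-! ### Set-valued maps -/

/-- Outer semicontinuity of `M` relative to `K`, through convergent sequences. -/
def OSCRelativeTo {P X : Type*} [TopologicalSpace P] [TopologicalSpace X]
    (M : P → Set X) (K : Set P) : Prop :=
  ∀ z ∈ K, ∀ (zs : ℕ → P) (ss : ℕ → X) (s : X),
    (∀ i, zs i ∈ K ∧ ss i ∈ M (zs i)) →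
    Tendsto zs atTop (𝓝 z) → Tendsto ss atTop (𝓝 s) → s ∈ M z

/-- Local boundedness of `M` relative to `K`. -/
def LBRelativeTo {P X : Type*} [TopologicalSpace P] [Bornology X]
    (M : P → Set X) (K : Set P) : Prop :=
  ∀ z ∈ K, ∃ N : Set P, IsOpen N ∧ z ∈ N ∧ Bornology.IsBounded (⋃ y ∈ N ∩ K, M y)

/-! ### Hybrid inclusions and their solutions -/

/-- Data `{C, F, D, G}` of a hybrid inclusion
`x ∈ C, ẋ ∈ F(x)`; `x ∈ D, x⁺ ∈ G(x)`. -/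
structure HybridSystem (X : Type*) where
  C : Set X
  F : X → Set X
  D : Set X
  G : X → Set X

/-- Compact hybrid time domains
`⋃_{j < J} [t_j, t_{j+1}] × {j}` with `0 = t_0 ≤ t_1 ≤ … ≤ t_J`. -/
def IsCompactHybridTimeDomain (E : Set (ℝ × ℕ)) : Prop :=
  ∃ (J : ℕ) (t : ℕ → ℝ), t 0 = 0 ∧ (∀ j < J, t j ≤ t (j + 1)) ∧
    E = {p | p.2 < J ∧ p.1 ∈ Icc (t p.2) (t (p.2 + 1))}

/-- Hybrid time domains: unions of nondecreasing sequences of compact ones. -/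
def IsHybridTimeDomain (E : Set (ℝ × ℕ)) : Prop :=
  ∃ Es : ℕ → Set (ℝ × ℕ), (∀ i, IsCompactHybridTimeDomain (Es i)) ∧ Monotone Es ∧ E = ⋃ i, Es i

/-- A hybrid arc: a function on a hybrid time domain, locally absolutely continuous in `t` on
every interval `I_j = {t | (t, j) ∈ dom}` with nonempty interior.
The values of `val` outside `dom` are irrelevant. -/
structure HybridArc (X : Type*) [NormedAddCommGroup X] where
  dom : Set (ℝ × ℕ)
  val : ℝ → ℕ → X
  isHybridTimeDomain : IsHybridTimeDomain dom
  locallyAC : ∀ j : ℕ, (interior {t | (t, j) ∈ dom}).Nonempty →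
    ∀ a b : ℝ, a ≤ b → (a, j) ∈ dom → (b, j) ∈ dom →
      AbsolutelyContinuousOnInterval (fun t => val t j) a b

/-- The interval `I_j = {t | (t, j) ∈ dom x}`. -/
def HybridArc.interval {X : Type*} [NormedAddCommGroup X] (x : HybridArc X) (j : ℕ) : Set ℝ :=
  {t | (t, j) ∈ x.dom}

/-- Solutions of a hybrid inclusion. -/
structure HybridSystem.IsSolution {X : Type*} [NormedAddCommGroup X] [NormedSpace ℝ X]
    (H : HybridSystem X) (x : HybridArc X) : Prop where
  zero_mem_dom : ((0 : ℝ), 0) ∈ x.dom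
  init : x.val 0 0 ∈ H.C ∪ H.D
  flow : ∀ j : ℕ, ∀ᵐ t ∂(volume.restrict (x.interval j)),
    x.val t j ∈ H.C ∧ ∃ v ∈ H.F (x.val t j), HasDerivAt (fun s => x.val s j) v t
  jump : ∀ (t : ℝ) (j : ℕ), (t, j) ∈ x.dom → (t, j + 1) ∈ x.dom →
    x.val t j ∈ H.D ∧ x.val t (j + 1) ∈ H.G (x.val t j)

/-- Boundedness of a hybrid arc. -/
def HybridArc.IsBounded {X : Type*} [NormedAddCommGroup X] (x : HybridArc X) : Prop :=
  Bornology.IsBounded {y | ∃ (t : ℝ) (j : ℕ), (t, j) ∈ x.dom ∧ x.val t j = y}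

/-- A hybrid arc is (forward) complete if its domain is unbounded. -/
def HybridArc.IsComplete {X : Type*} [NormedAddCommGroup X] (x : HybridArc X) : Prop :=
  ¬ Bornology.IsBounded x.dom

/-- `|x(t, j)|_A → 0` as `t + j → ∞` in the domain of `x`. -/
def HybridArc.ConvergesTo {X : Type*} [NormedAddCommGroup X]
    (x : HybridArc X) (A : Set X) : Prop :=
  ∀ ε > 0, ∃ T : ℝ, ∀ (t : ℝ) (j : ℕ), (t, j) ∈ x.dom → T ≤ t + j →
    Metric.infDist (x.val t j) A < ε

/-- The basin of attraction of `A` relative to the state space `C ∪ D`: all points of `C ∪ D` from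
which every solution is bounded and, if complete, converges to `A`. -/
def HybridSystem.basin {X : Type*} [NormedAddCommGroup X] [NormedSpace ℝ X]
    (H : HybridSystem X) (A : Set X) : Set X :=
  {x₀ | x₀ ∈ H.C ∪ H.D ∧ ∀ x : HybridArc X, H.IsSolution x → x.val 0 0 = x₀ →
    x.IsBounded ∧ (x.IsComplete → x.ConvergesTo A)}

/-- The compact set `A` is uniformly asymptotically stable with basin of attraction `S`:
`S` is a relatively open subset of the state space `C ∪ D` that contains `A` and equals the basin
of attraction of `A`; all solutions that start in `S` stay in `S`; and, for every proper indicator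
`ω` of `A` on `S`, they satisfy a `𝒦ℒ` bound `ω (x (t, j)) ≤ β (ω (x (0, 0)), t + j)`. The bound is
required of all solutions, in particular of the maximal ones. -/
structure HybridSystem.IsUASWithBasin {X : Type*} [NormedAddCommGroup X] [NormedSpace ℝ X]
    (H : HybridSystem X) (A S : Set X) : Prop where
  isCompact : IsCompact A
  subset : A ⊆ S
  relOpen : ∃ O : Set X, IsOpen O ∧ S = O ∩ (H.C ∪ H.D)
  invariant : ∀ x : HybridArc X, H.IsSolution x → x.val 0 0 ∈ S →
    ∀ (t : ℝ) (j : ℕ), (t, j) ∈ x.dom → x.val t j ∈ S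
  bound : ∀ ω : X → ℝ≥0, IsProperIndicator ω A S →
    ∃ β : ℝ≥0 → ℝ≥0 → ℝ≥0, IsClassKL β ∧
      ∀ x : HybridArc X, H.IsSolution x → x.val 0 0 ∈ S →
        ∀ (t : ℝ) (j : ℕ), (t, j) ∈ x.dom →
          ω (x.val t j) ≤ β (ω (x.val 0 0)) (t + j).toNNReal
  basin_eq : H.basin A = S

/-! ### Hybrid decision-making dynamics -/

/-- Data `{C, F̂, D, Ĝ}` of hybrid decision-making dynamics (without tunable parameter) with state
`(û, ẑ) ∈ U × Z` and input `ξ ∈ U`. -/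
structure DecisionDynamics (U Z : Type*) where
  C : Set (U × Z)
  F : U × Z → U → Set (U × Z)
  D : Set (U × Z)
  G : U × Z → Set (U × Z)

/-- Regularity of hybrid decision-making dynamics with constraint set `Uhat` for `û`. -/
structure DecisionDynamics.IsRegular {U Z : Type*}
    [NormedAddCommGroup U] [NormedSpace ℝ U] [NormedAddCommGroup Z] [NormedSpace ℝ Z]
    (H : DecisionDynamics U Z) (Uhat : Set U) : Prop where
  closed_C : IsClosed H.C
  closed_D : IsClosed H.D
  proj_C : Prod.fst '' H.C ⊆ Uhat
  proj_D : Prod.fst '' H.D ⊆ Uhat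
  osc_F : OSCRelativeTo (fun p : (U × Z) × U => H.F p.1 p.2) (H.C ×ˢ univ)
  lb_F : LBRelativeTo (fun p : (U × Z) × U => H.F p.1 p.2) (H.C ×ˢ univ)
  convex_F : ∀ x ∈ H.C, ∀ ξ : U, Convex ℝ (H.F x ξ)
  osc_G : OSCRelativeTo H.G H.D
  lb_G : LBRelativeTo H.G H.D

/-- The target system: the input `ξ` is replaced by a gradient. The gradient is given as a
set-valued map `grad`, empty at the points where the gradient does not exist. -/
def DecisionDynamics.target {U Z : Type*} (H : DecisionDynamics U Z) (grad : U × Z → Set U) :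
    HybridSystem (U × Z) where
  C := H.C
  F x := {v | ∃ ξ ∈ grad x, v ∈ H.F x ξ}
  D := H.D
  G := H.G

/-! ### Source seeking with an obstacle in the plane -/

namespace SourceSeeking

/-- The plane with the Euclidean norm. -/
abbrev Plane : Type := EuclideanSpace ℝ (Fin 2)

/-- The set `𝒬 = {1, 2}` of logic modes, as a subset of `ℝ`. -/
def modes : Set ℝ := {1, 2}

/-- `𝓛₁ = L₁ₐ ∪ L₁ᵦ`: the points that lie below one of the two lines through the lower
sides of the square `‖p - p₀‖₁ ≤ 2 r √2`. -/
def region1 (p₀ : Plane) (r : ℝ) : Set Plane :=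
  {p | p 1 < -p 0 + p₀ 1 + p₀ 0 - 2 * r * √2} ∪ {p | p 1 < p 0 + p₀ 1 - p₀ 0 - 2 * r * √2}

/-- `𝓛₂ = L₂ₐ ∪ L₂ᵦ`: the points that lie above one of the two lines through the upper
sides of the square `‖p - p₀‖₁ ≤ 2 r √2`. -/
def region2 (p₀ : Plane) (r : ℝ) : Set Plane :=
  {p | p 1 > p 0 + p₀ 1 - p₀ 0 + 2 * r * √2} ∪ {p | p 1 > -p 0 + p₀ 1 + p₀ 0 + 2 * r * √2}

open Classical in
/-- The region `𝓛_q` of mode `q` (used for `q ∈ {1, 2}` only). -/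
def region (p₀ : Plane) (r : ℝ) (q : ℝ) : Set Plane :=
  if q = 1 then region1 p₀ r else region2 p₀ r

/-- `𝒰 = 𝓛₁ ∪ 𝓛₂`. -/
def freeSpace (p₀ : Plane) (r : ℝ) : Set Plane :=
  region1 p₀ r ∪ region2 p₀ r

/-- The finite part `-J + B_q` of the mode-dependent potential. -/
def potential (J : Plane → ℝ) (B : ℝ → Plane → ℝ) (q : ℝ) : Plane → ℝ :=
  fun u => -J u + B q u

open Classical in
/-- The mode-dependent potential `Ĵ_q`: it is `-J + B_q` on `𝓛_q` and `∞` outside `𝓛_q`. -/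
def Jhat (p₀ : Plane) (r : ℝ) (J : Plane → ℝ) (B : ℝ → Plane → ℝ) (q : ℝ) (u : Plane) : EReal :=
  if u ∈ region p₀ r q then ((potential J B q u : ℝ) : EReal) else ⊤

/-- `W(û, q) = Ĵ_q(û) + J(u⋆)`. -/
def W (p₀ : Plane) (r : ℝ) (J : Plane → ℝ) (B : ℝ → Plane → ℝ) (uStar : Plane)
    (u : Plane) (q : ℝ) : EReal :=
  Jhat p₀ r J B q u + ((J uStar : ℝ) : EReal)

/-- The assumption on mode-dependent barrier functions. -/
structure BarrierAssumption (p₀ : Plane) (r : ℝ) (J : Plane → ℝ) (B : ℝ → Plane → ℝ)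
    (uStar : Plane) : Prop where
  nonneg : ∀ q ∈ modes, ∀ u, 0 ≤ Jhat p₀ r J B q u
  contDiffOn : ∀ q ∈ modes, ContDiffOn ℝ 1 (potential J B q) (region p₀ r q)
  tendsto_infty : ∀ q ∈ modes, Tendsto (Jhat p₀ r J B q) (cocompact Plane) (𝓝 ⊤)
  tendsto_boundary : ∀ q ∈ modes, ∀ z ∈ frontier (region p₀ r q),
    Tendsto (Jhat p₀ r J B q) (𝓝 z) (𝓝 ⊤)
  indicator_bounds : ∃ (α₁ α₂ : ℝ≥0 → ℝ≥0) (ϖ : Plane → ℝ≥0),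
    IsClassKInf α₁ ∧ IsClassKInf α₂ ∧ IsProperIndicator ϖ {uStar} (freeSpace p₀ r) ∧
    ∀ u ∈ freeSpace p₀ r,
      (((α₁ (ϖ u) : ℝ≥0) : ℝ) : EReal) ≤ min (W p₀ r J B uStar u 1) (W p₀ r J B uStar u 2) ∧
      min (W p₀ r J B uStar u 1) (W p₀ r J B uStar u 2) ≤ (((α₂ (ϖ u) : ℝ≥0) : ℝ) : EReal)
  gradient_bound : ∃ ϱ : ℝ → ℝ, IsPosDefFun ϱ ∧ ∀ q ∈ modes, ∀ u ∈ region p₀ r q,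
    ϱ (W p₀ r J B uStar u q).toReal ≤ ‖gradient (potential J B q) u‖ ^ 2

/-- The gradient `∇Ĵ_q(û)` as a set-valued map of `(û, q)`: a singleton where `Ĵ_q` is finite and
differentiable, and empty elsewhere. -/
def gradJhat (p₀ : Plane) (r : ℝ) (J : Plane → ℝ) (B : ℝ → Plane → ℝ) (x : Plane × ℝ) :
    Set Plane :=
  {ξ | x.1 ∈ region p₀ r x.2 ∧ HasGradientAt (potential J B x.2) ξ x.1}

/-- The hysteresis-based decision-making dynamics with state `(û, q)`: flows `û' = -ξ`, `q' = 0`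
while `Ĵ_q(û) ≤ χ Ĵ_{3-q}(û)`; jumps `û⁺ = û`, `q⁺ = 3 - q` while
`Ĵ_q(û) ≥ (χ - l) Ĵ_{3-q}(û)`. -/
def dynamics (p₀ : Plane) (r : ℝ) (J : Plane → ℝ) (B : ℝ → Plane → ℝ) (χ l : ℝ) :
    DecisionDynamics Plane ℝ where
  C := {x | x.1 ∈ closure (freeSpace p₀ r) ∧ x.2 ∈ modes ∧
    Jhat p₀ r J B x.2 x.1 ≤ (χ : EReal) * Jhat p₀ r J B (3 - x.2) x.1}
  F := fun _ ξ => {(-ξ, 0)}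
  D := {x | x.1 ∈ closure (freeSpace p₀ r) ∧ x.2 ∈ modes ∧
    ((χ - l : ℝ) : EReal) * Jhat p₀ r J B (3 - x.2) x.1 ≤ Jhat p₀ r J B x.2 x.1}
  G := fun x => {(x.1, 3 - x.2)}

end SourceSeeking

end

/-! ### Hybrid time domains -/

/-! The Lyapunov function is `V(û, q) = Ĵ_q(û) + J(u⋆)`. A minimizer of `Ĵ_q` exists by coercivity
and is a critical point; the gradient bound then forces `V ≤ 0` there, and the indicator bound
forces it to be `u⋆`. Hence `u⋆` lies in both regions, `V` vanishes exactly on the target set, and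
`J(u⋆) = -Ĵ_q(u⋆) ≤ 0` (`uStar_mem_region_and`, `J_uStar_nonpos`).

Flows are steepest descent: `V` decreases at rate `‖∇Ĵ_q‖²`, and the barrier keeps `û` in `𝓛_q`
(`mem_of_descent`, `flow_step`). At a jump, `(χ - λ) Ĵ_{3-q} ≤ Ĵ_q` and `J(u⋆) ≤ 0` give `(χ - λ) V⁺
≤ V` with `χ - λ > 1` (`lyapunov_jump`). On a compact shell `a ≤ V ≤ b` with `a > 0` the gradients
are bounded away from zero, so `V` drops at least linearly in `t + j` until it is below `a`
(`sublevel_decay`).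

An initial state in `𝒰 × 𝒬` may have `V = ∞`. It then lies outside the flow set, and its only
possible move is a jump to the mode with finite potential. All estimates therefore start after the
first flow or jump, with constants uniform over compact sets of initial states. Compactness of the
sublevel sets of `V` and of proper indicators converts these estimates into a `𝒦ℒ` bound
(`exists_KL_bound`). Points outside `𝒰` are not in the basin because both potentials are infinite
there, which allows switching forever without moving. -/

theorem IsHybridTimeDomain.induction {E : Set (ℝ × ℕ)} (hE : IsHybridTimeDomain E)
    {P : ℝ → ℕ → Prop} (h0 : P 0 0)
    (hflow : ∀ s t j, (s, j) ∈ E → (t, j) ∈ E → s < t → P s j → P t j)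
    (hjump : ∀ t j, (t, j) ∈ E → (t, j + 1) ∈ E → P t j → P t (j + 1)) :
    ∀ t j, (t, j) ∈ E → P t j := by
  obtain ⟨Es, hEs, -, rfl⟩ := hE
  intro t j htj
  obtain ⟨i, hi⟩ := mem_iUnion.1 htj
  obtain ⟨K, τ, hτ0, hτ, hEq⟩ := hEs i
  have hmem : ∀ s k, k < K → s ∈ Icc (τ k) (τ (k + 1)) → (s, k) ∈ ⋃ i, Es i := by
    intro s k hk hs
    refine mem_iUnion.2 ⟨i, ?_⟩
    rw [hEq]
    exact ⟨hk, hs⟩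
  have hflow' : ∀ k, k < K → P (τ k) k → ∀ s ∈ Icc (τ k) (τ (k + 1)), P s k := by
    intro k hk hP s hs
    rcases eq_or_lt_of_le hs.1 with h | h
    · rwa [← h]
    · exact hflow _ _ _ (hmem _ _ hk ⟨le_rfl, hτ k hk⟩) (hmem _ _ hk hs) h hP
  have hstart : ∀ k, k < K → P (τ k) k := by
    intro k
    induction k with
    | zero => intro _; rwa [hτ0]
    | succ k ih =>
      intro hk
      have hk' : k < K := by omega
      exact hjump _ _ (hmem _ _ hk' ⟨hτ k hk', le_rfl⟩) (hmem _ _ hk ⟨le_rfl, hτ _ hk⟩)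
        (hflow' k hk' (ih hk') _ ⟨hτ k hk', le_rfl⟩)
  rw [hEq] at hi
  exact hflow' j hi.1 (hstart j hi.1) t hi.2

theorem IsHybridTimeDomain.nonneg {E : Set (ℝ × ℕ)} (hE : IsHybridTimeDomain E) :
    ∀ t j, (t, j) ∈ E → 0 ≤ t :=
  hE.induction le_rfl (fun _ _ _ _ _ h h' => h'.trans h.le) (fun _ _ _ _ h => h)

theorem IsHybridTimeDomain.Icc_subset {E : Set (ℝ × ℕ)} (hE : IsHybridTimeDomain E)
    {s t : ℝ} {j : ℕ} (hs : (s, j) ∈ E) (ht : (t, j) ∈ E) :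
    Icc s t ⊆ {τ | (τ, j) ∈ E} := by
  obtain ⟨Es, hEs, hmono, rfl⟩ := hE
  obtain ⟨i, hi⟩ := mem_iUnion.1 hs
  obtain ⟨k, hk⟩ := mem_iUnion.1 ht
  have hi' := hmono (le_max_left i k) hi
  have hk' := hmono (le_max_right i k) hk
  intro τ hτ
  refine mem_iUnion.2 ⟨max i k, ?_⟩
  obtain ⟨K, θ, -, -, hEq⟩ := hEs (max i k)
  rw [hEq] at hi' hk' ⊢
  exact ⟨hi'.1, hi'.2.1.trans hτ.1, hτ.2.trans hk'.2.2⟩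

/-! ### Gradient flow along absolutely continuous curves -/

section GradientFlow

theorem AbsolutelyContinuousOnInterval.comp_lipschitz {X Y : Type*} [PseudoMetricSpace X]
    [PseudoMetricSpace Y] {f : ℝ → X} {g : X → Y} {a b : ℝ}
    (hf : AbsolutelyContinuousOnInterval f a b) (hg : LipschitzWith 1 g) :
    AbsolutelyContinuousOnInterval (fun t => g (f t)) a b := by
  rw [absolutelyContinuousOnInterval_iff] at hf ⊢
  intro ε hε
  obtain ⟨δ, hδ, h⟩ := hf ε hε
  refine ⟨δ, hδ, fun I hI hlt => lt_of_le_of_lt (Finset.sum_le_sum fun i _ => ?_) (h I hI hlt)⟩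
  simpa using hg.dist_le_mul (f (I.2 i).1) (f (I.2 i).2)

variable {E : Type*} [NormedAddCommGroup E] [InnerProductSpace ℝ E] [CompleteSpace E]

/-- An absolutely continuous curve whose a.e. derivative is continuous is differentiable. -/
theorem AbsolutelyContinuousOnInterval.hasDerivAt_of_continuousOn {u h : ℝ → E} {a b : ℝ}
    (hab : a ≤ b) (hu : AbsolutelyContinuousOnInterval u a b) (hh : ContinuousOn h (Icc a b))
    (hd : ∀ᵐ t, t ∈ Icc a b → HasDerivAt u (h t) t) :
    ∀ t ∈ Ioo a b, HasDerivAt u (h t) t := by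
  -- Extending `h` continuously to the line makes its primitive `C¹` everywhere. The curve minus
  -- this primitive is absolutely continuous with zero derivative a.e., hence constant.
  set k : ℝ → E := IccExtend hab ((Icc a b).domRestrict h) with hk
  have hkc : Continuous k := continuous_IccExtend_iff.2 hh.domRestrict
  have hke : ∀ t ∈ Icc a b, k t = h t := fun t ht => by
    rw [hk, IccExtend_of_mem hab _ ht]; rfl
  have hw : ∀ t, HasDerivAt (fun s => ∫ τ in a..s, k τ) (k t) t := fun t =>
    (hkc.integral_hasStrictDerivAt a t).hasDerivAt
  have hwC : ContDiff ℝ 1 (fun s => ∫ τ in a..s, k τ) := by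
    rw [contDiff_one_iff_deriv]
    refine ⟨fun t => (hw t).differentiableAt, ?_⟩
    rwa [show deriv (fun s => ∫ τ in a..s, k τ) = k from funext fun t => (hw t).deriv]
  obtain ⟨c, hc⟩ := (hu.sub
    hwC.contDiffOn.absolutelyContinuousOnInterval).const_of_ae_hasDerivAt_zero (by
      filter_upwards [hd] with t ht hmem
      rw [uIcc_of_le hab] at hmem
      have := (ht hmem).sub (hw t)
      rwa [hke t hmem, sub_self] at this)
  rw [uIcc_of_le hab] at hc
  intro t ht
  have h1 : HasDerivAt (fun s => c + ∫ τ in a..s, k τ) (h t) t := by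
    rw [← hke t (Ioo_subset_Icc_self ht)]
    exact (hw t).const_add c
  refine h1.congr_of_eventuallyEq ?_
  filter_upwards [Icc_mem_nhds ht.1 ht.2] with s hs
  rw [← hc s hs]
  simp

/-- Along a curve of steepest descent that stays in the domain of the potential, the potential
decreases at the rate of the squared norm of the gradient. -/
theorem hasDerivAt_potential_of_descent {f : E → ℝ} {L : Set E} (hL : IsOpen L)
    (hf : ContDiffOn ℝ 1 f L) {u : ℝ → E} {a b : ℝ} (hab : a ≤ b)
    (hu : AbsolutelyContinuousOnInterval u a b)
    (hd : ∀ᵐ t, t ∈ Icc a b → HasDerivAt u (-gradient f (u t)) t)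
    (hmem : ∀ t ∈ Icc a b, u t ∈ L) :
    ContinuousOn (fun t => f (u t)) (Icc a b) ∧
      ∀ t ∈ Ioo a b, HasDerivAt (fun t => f (u t)) (-‖gradient f (u t)‖ ^ 2) t := by
  have huc : ContinuousOn u (Icc a b) := by simpa [uIcc_of_le hab] using hu.continuousOn
  have hgc : ContinuousOn (gradient f) L := by
    have h1 : ContinuousOn (fderiv ℝ f) L := hf.continuousOn_fderiv_of_isOpen hL le_rfl
    exact (InnerProductSpace.toDual ℝ E).symm.continuous.comp_continuousOn h1
  have hder := hu.hasDerivAt_of_continuousOn hab (hgc.comp huc hmem).neg hd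
  refine ⟨hf.continuousOn.comp huc hmem, fun t ht => ?_⟩
  have hfd : HasGradientAt f (gradient f (u t)) (u t) :=
    ((hf.differentiableOn one_ne_zero).differentiableAt
      (hL.mem_nhds (hmem t (Ioo_subset_Icc_self ht)))).hasGradientAt
  have h2 := hfd.hasFDerivAt.comp_hasDerivAt t (hder t ht)
  have h3 : inner ℝ (gradient f (u t)) (-gradient f (u t)) = -‖gradient f (u t)‖ ^ 2 := by
    rw [inner_neg_right, real_inner_self_eq_norm_sq]
  rw [← h3]
  exact h2

theorem potential_le_of_descent {f : E → ℝ} {L : Set E} (hL : IsOpen L)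
    (hf : ContDiffOn ℝ 1 f L) {u : ℝ → E} {a b : ℝ} (hab : a ≤ b)
    (hu : AbsolutelyContinuousOnInterval u a b)
    (hd : ∀ᵐ t, t ∈ Icc a b → HasDerivAt u (-gradient f (u t)) t)
    (hmem : ∀ t ∈ Icc a b, u t ∈ L) : AntitoneOn (fun t => f (u t)) (Icc a b) := by
  obtain ⟨hc, hder⟩ := hasDerivAt_potential_of_descent hL hf hab hu hd hmem
  refine antitoneOn_of_deriv_nonpos (convex_Icc a b) hc ?_ ?_
  · rw [interior_Icc]
    exact fun t ht => (hder t ht).differentiableAt.differentiableWithinAt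
  · rw [interior_Icc]
    intro t ht
    rw [(hder t ht).deriv]
    simp

theorem potential_decay_of_descent {f : E → ℝ} {L : Set E} (hL : IsOpen L)
    (hf : ContDiffOn ℝ 1 f L) {u : ℝ → E} {a b : ℝ} (hab : a ≤ b)
    (hu : AbsolutelyContinuousOnInterval u a b)
    (hd : ∀ᵐ t, t ∈ Icc a b → HasDerivAt u (-gradient f (u t)) t)
    (hmem : ∀ t ∈ Icc a b, u t ∈ L) {δ m M : ℝ}
    (hδ : ∀ v ∈ L, m ≤ f v → f v ≤ M → δ ≤ ‖gradient f v‖ ^ 2) (hM : f (u a) ≤ M) :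
    f (u b) ≤ max m (f (u a) - δ * (b - a)) := by
  have hanti := potential_le_of_descent hL hf hab hu hd hmem
  obtain ⟨hc, hder⟩ := hasDerivAt_potential_of_descent hL hf hab hu hd hmem
  rcases le_total (f (u b)) m with h | h
  · exact h.trans (le_max_left _ _)
  refine le_trans ?_ (le_max_right _ _)
  -- As `f ∘ u` is nonincreasing and still at least `m` at time `b`, the whole curve stays in the
  -- shell where the gradient bound applies.
  have hrange : ∀ t ∈ Icc a b, m ≤ f (u t) ∧ f (u t) ≤ M := fun t ht =>
    ⟨h.trans (hanti ht ⟨hab, le_rfl⟩ ht.2), (hanti ⟨le_rfl, hab⟩ ht ht.1).trans hM⟩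
  have hmain : AntitoneOn (fun t => f (u t) + δ * t) (Icc a b) := by
    refine antitoneOn_of_deriv_nonpos (convex_Icc a b)
      (hc.add (continuous_const.mul continuous_id).continuousOn) ?_ ?_
    · rw [interior_Icc]
      exact fun t ht => ((hder t ht).add
        ((hasDerivAt_id t).const_mul δ)).differentiableAt.differentiableWithinAt
    · rw [interior_Icc]
      intro t ht
      have ht' := Ioo_subset_Icc_self ht
      have h3 := ((hder t ht).add ((hasDerivAt_id t).const_mul δ)).deriv
      have h4 := hδ (u t) (hmem t ht') (hrange t ht').1 (hrange t ht').2
      have h5 : deriv (fun t => f (u t) + δ * t) t = -‖gradient f (u t)‖ ^ 2 + δ * 1 := h3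
      rw [h5]
      linarith
  have := hmain ⟨le_rfl, hab⟩ ⟨hab, le_rfl⟩ hab
  simp only at this
  linarith

/-- A curve of steepest descent cannot leave the domain of a potential that blows up at the
boundary. -/
theorem mem_of_descent {f : E → ℝ} {L : Set E} (hL : IsOpen L) (hf : ContDiffOn ℝ 1 f L)
    {φ : E → EReal} (hφ : Continuous φ) (hφL : ∀ v ∈ L, φ v = f v) (hφt : ∀ v ∉ L, φ v = ⊤)
    {u : ℝ → E} {a b : ℝ} (hab : a ≤ b)
    (hu : AbsolutelyContinuousOnInterval u a b)
    (hd : ∀ᵐ t, t ∈ Icc a b → HasDerivAt u (-gradient f (u t)) t)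
    (ha : u a ∈ L) : ∀ t ∈ Icc a b, u t ∈ L := by
  have huc : ContinuousOn u (Icc a b) := by simpa [uIcc_of_le hab] using hu.continuousOn
  by_contra! hne
  -- The first exit time `s` leads to a contradiction: before `s` the potential is at most `f (u
  -- a)`, so by continuity `φ (u s)` is finite, whereas `φ = ⊤` off `L`.
  set S := Icc a b ∩ u ⁻¹' Lᶜ with hS
  have hSc : IsClosed S := huc.preimage_isClosed_of_isClosed isClosed_Icc hL.isClosed_compl
  have hSne : S.Nonempty := hne
  have hSb : BddBelow S := ⟨a, fun t ht => ht.1.1⟩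
  have hs := hSc.csInf_mem hSne hSb
  set s := sInf S
  have has : a < s := lt_of_le_of_ne hs.1.1 fun h => hs.2 (h ▸ ha)
  have hle : ∀ t ∈ Ico a s, φ (u t) ≤ f (u a) := by
    intro t ht
    have hin : ∀ τ ∈ Icc a t, u τ ∈ L := by
      intro τ hτ
      by_contra hτL
      have : s ≤ τ := csInf_le hSb ⟨⟨hτ.1, hτ.2.trans (ht.2.le.trans hs.1.2)⟩, hτL⟩
      linarith [hτ.2, ht.2]
    have hsub : Icc a t ⊆ Icc a b := Icc_subset_Icc_right (ht.2.le.trans hs.1.2)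
    have := potential_le_of_descent hL hf ht.1
      (hu.mono (by rwa [uIcc_of_le hab, uIcc_of_le ht.1]))
      (by filter_upwards [hd] with τ hτ h using hτ (hsub h)) hin
      ⟨le_rfl, ht.1⟩ ⟨ht.1, le_rfl⟩ ht.1
    rw [hφL _ (hin t ⟨ht.1, le_rfl⟩)]
    exact_mod_cast this
  have hcw : ContinuousWithinAt (fun t => φ (u t)) (Ico a s) s :=
    hφ.continuousAt.comp_continuousWithinAt
      ((huc s hs.1).mono fun t ht => ⟨ht.1, ht.2.le.trans hs.1.2⟩)
  have hcl : s ∈ closure (Ico a s) := by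
    rw [closure_Ico has.ne]
    exact ⟨has.le, le_rfl⟩
  have : NeBot (𝓝[Ico a s] s) := mem_closure_iff_nhdsWithin_neBot.1 hcl
  have hlim : φ (u s) ≤ f (u a) := le_of_tendsto hcw (by
    filter_upwards [self_mem_nhdsWithin] with t ht using hle t ht)
  rw [hφt _ hs.2] at hlim
  exact absurd hlim (by simp)

end GradientFlow

namespace SourceSeeking

/-! ### The two regions and the extended potentials -/

section Geometry

variable {p₀ : Plane} {r : ℝ}

theorem isOpen_region1 : IsOpen (region1 p₀ r) :=
  (isOpen_lt (by fun_prop) (by fun_prop)).union (isOpen_lt (by fun_prop) (by fun_prop))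

theorem isOpen_region2 : IsOpen (region2 p₀ r) :=
  (isOpen_lt (by fun_prop) (by fun_prop)).union (isOpen_lt (by fun_prop) (by fun_prop))

theorem isOpen_region (q : ℝ) : IsOpen (region p₀ r q) := by
  unfold region
  split_ifs
  exacts [isOpen_region1, isOpen_region2]

theorem isOpen_freeSpace : IsOpen (freeSpace p₀ r) :=
  isOpen_region1.union isOpen_region2

theorem region_subset_freeSpace (q : ℝ) : region p₀ r q ⊆ freeSpace p₀ r := by
  unfold region
  split_ifs
  exacts [subset_union_left, subset_union_right]

theorem region_nonempty (q : ℝ) : (region p₀ r q).Nonempty := by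
  unfold region
  split_ifs
  · refine ⟨!₂[p₀ 0, p₀ 1 - 2 * r * √2 - 1], Or.inl ?_⟩
    simp
  · refine ⟨!₂[p₀ 0, p₀ 1 + 2 * r * √2 + 1], Or.inl ?_⟩
    simp

theorem modes_cases {q : ℝ} (hq : q ∈ modes) : q = 1 ∨ q = 2 := hq

theorem three_sub_mem_modes {q : ℝ} (hq : q ∈ modes) : 3 - q ∈ modes := by
  rcases modes_cases hq with rfl | rfl
  · exact Or.inr (by norm_num)
  · exact Or.inl (by norm_num)

theorem mem_region_or {q : ℝ} (hq : q ∈ modes) {u : Plane} (hu : u ∈ freeSpace p₀ r) :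
    u ∈ region p₀ r q ∨ u ∈ region p₀ r (3 - q) := by
  have h1 : region p₀ r 1 = region1 p₀ r := by simp [region]
  have h2 : region p₀ r 2 = region2 p₀ r := by simp [region]
  rcases modes_cases hq with rfl | rfl
  · rw [show (3 : ℝ) - 1 = 2 by norm_num, h1, h2]
    exact hu
  · rw [show (3 : ℝ) - 2 = 1 by norm_num, h1, h2]
    exact hu.symm

variable {J : Plane → ℝ} {B : ℝ → Plane → ℝ}

theorem Jhat_of_mem {q : ℝ} {u : Plane} (hu : u ∈ region p₀ r q) :
    Jhat p₀ r J B q u = (potential J B q u : ℝ) := if_pos hu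

theorem Jhat_of_notMem {q : ℝ} {u : Plane} (hu : u ∉ region p₀ r q) :
    Jhat p₀ r J B q u = ⊤ := if_neg hu

theorem mem_region_of_Jhat_lt_top {q : ℝ} {u : Plane} (h : Jhat p₀ r J B q u < ⊤) :
    u ∈ region p₀ r q := by
  by_contra hu
  rw [Jhat_of_notMem hu] at h
  exact lt_irrefl _ h

end Geometry

/-! ### Consequences of the barrier assumption -/

namespace BarrierAssumption

variable {p₀ uStar : Plane} {r : ℝ} {J : Plane → ℝ} {B : ℝ → Plane → ℝ}

/-- Inside the region this is smoothness of the potential, on its frontier the blow-up condition,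
and in the exterior local constancy. -/
theorem continuous_Jhat (hB : BarrierAssumption p₀ r J B uStar) {q : ℝ} (hq : q ∈ modes) :
    Continuous (Jhat p₀ r J B q) := by
  rw [continuous_iff_continuousAt]
  intro u
  by_cases hu : u ∈ region p₀ r q
  · have h1 : ContinuousAt (fun v => ((potential J B q v : ℝ) : EReal)) u :=
      continuous_coe_real_ereal.continuousAt.comp
        ((hB.contDiffOn q hq).continuousOn.continuousAt ((isOpen_region q).mem_nhds hu))
    refine h1.congr ?_
    filter_upwards [(isOpen_region q).mem_nhds hu] with v hv using (Jhat_of_mem hv).symm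
  by_cases hc : u ∈ closure (region p₀ r q)
  · have hf : u ∈ frontier (region p₀ r q) := ⟨hc, by rwa [(isOpen_region q).interior_eq]⟩
    have := hB.tendsto_boundary q hq u hf
    rwa [ContinuousAt, Jhat_of_notMem hu]
  · have hn : (closure (region p₀ r q))ᶜ ∈ 𝓝 u := isClosed_closure.isOpen_compl.mem_nhds hc
    refine (continuousAt_const (y := (⊤ : EReal))).congr ?_
    filter_upwards [hn] with v hv
    exact (Jhat_of_notMem fun h => hv (subset_closure h)).symm

theorem potential_nonneg (hB : BarrierAssumption p₀ r J B uStar) {q : ℝ} (hq : q ∈ modes)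
    {u : Plane} (hu : u ∈ region p₀ r q) : 0 ≤ potential J B q u := by
  have := hB.nonneg q hq u
  rw [Jhat_of_mem hu] at this
  exact_mod_cast this

theorem isCompact_Jhat_le (hB : BarrierAssumption p₀ r J B uStar) {q : ℝ} (hq : q ∈ modes)
    (c : ℝ) : IsCompact {u | Jhat p₀ r J B q u ≤ c} := by
  have hev : ∀ᶠ u in cocompact Plane, (c : EReal) < Jhat p₀ r J B q u :=
    (hB.tendsto_infty q hq).eventually (lt_mem_nhds (EReal.coe_lt_top c))
  obtain ⟨K, hK, hKs⟩ := mem_cocompact.1 hev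
  refine hK.of_isClosed_subset (isClosed_le (hB.continuous_Jhat hq) continuous_const) ?_
  intro u hu
  by_contra h
  exact not_le.2 (show _ < Jhat p₀ r J B q u from hKs h) hu

theorem potential_add_pos (hB : BarrierAssumption p₀ r J B uStar) {q : ℝ} (hq : q ∈ modes)
    {u : Plane} (hu : u ∈ region p₀ r q) (hne : u ≠ uStar) :
    0 < potential J B q u + J uStar := by
  obtain ⟨α₁, α₂, ϖ, h1, -, hϖ, hb⟩ := hB.indicator_bounds
  have hU := region_subset_freeSpace q hu
  have hpos : 0 < α₁ (ϖ u) := by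
    have : ϖ u ≠ 0 := fun h => hne ((hϖ.eq_zero_iff u hU).1 h)
    calc (0 : ℝ≥0) = α₁ 0 := h1.map_zero.symm
      _ < α₁ (ϖ u) := h1.strictMono (pos_iff_ne_zero.2 this)
  have hle : (((α₁ (ϖ u) : ℝ≥0) : ℝ) : EReal) ≤ W p₀ r J B uStar u q := by
    refine (hb u hU).1.trans ?_
    rcases modes_cases hq with rfl | rfl
    exacts [min_le_left _ _, min_le_right _ _]
  rw [W, Jhat_of_mem hu, ← EReal.coe_add, EReal.coe_le_coe_iff] at hle
  exact lt_of_lt_of_le (by exact_mod_cast hpos) hle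

theorem gradient_ne_zero (hB : BarrierAssumption p₀ r J B uStar) {q : ℝ} (hq : q ∈ modes)
    {u : Plane} (hu : u ∈ region p₀ r q) (h : 0 < potential J B q u + J uStar) :
    gradient (potential J B q) u ≠ 0 := by
  obtain ⟨ϱ, hϱ, hb⟩ := hB.gradient_bound
  intro h0
  have := hb q hq u hu
  rw [h0, W, Jhat_of_mem hu, ← EReal.coe_add, EReal.toReal_coe] at this
  have h2 := hϱ.2 _ h
  simp at this
  linarith

/-- A minimizer of `Ĵ_q` has zero gradient, so the gradient bound rules out positive `W` there;
positivity of `W` away from `u⋆` then identifies the minimizer. -/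
theorem uStar_mem_region_and (hB : BarrierAssumption p₀ r J B uStar) {q : ℝ} (hq : q ∈ modes) :
    uStar ∈ region p₀ r q ∧ potential J B q uStar + J uStar = 0 := by
  obtain ⟨v, hv⟩ := region_nonempty (p₀ := p₀) (r := r) q
  obtain ⟨z, hz, hmin⟩ := (hB.isCompact_Jhat_le hq (potential J B q v)).exists_isMinOn
    ⟨v, (Jhat_of_mem hv).le⟩ (hB.continuous_Jhat hq).continuousOn
  have hzL : z ∈ region p₀ r q :=
    mem_region_of_Jhat_lt_top (lt_of_le_of_lt hz (EReal.coe_lt_top _))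
  have hloc : IsLocalMin (potential J B q) z := by
    filter_upwards [(isOpen_region q).mem_nhds hzL] with w hw
    have : Jhat p₀ r J B q z ≤ Jhat p₀ r J B q w := by
      -- Minimality on one sublevel set is global: points outside it have larger value.
      rcases le_total (Jhat p₀ r J B q w) (potential J B q v : ℝ) with h | h
      · exact hmin h
      · exact le_trans hz h
    rw [Jhat_of_mem hzL, Jhat_of_mem hw] at this
    exact_mod_cast this
  have hg : gradient (potential J B q) z = 0 := by
    rw [gradient, hloc.fderiv_eq_zero, map_zero]
  have hnp : ¬ 0 < potential J B q z + J uStar := fun h => hB.gradient_ne_zero hq hzL h hg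
  have hzu : z = uStar := by
    by_contra hne
    exact hnp (hB.potential_add_pos hq hzL hne)
  refine ⟨hzu ▸ hzL, le_antisymm (not_lt.1 (hzu ▸ hnp)) ?_⟩
  obtain ⟨α₁, α₂, ϖ, -, -, -, hb⟩ := hB.indicator_bounds
  have hU := region_subset_freeSpace q hzL
  have hle : (0 : EReal) ≤ W p₀ r J B uStar z q := by
    refine le_trans (by exact_mod_cast (α₁ (ϖ z)).2) ((hb z hU).1.trans ?_)
    rcases modes_cases hq with rfl | rfl
    exacts [min_le_left _ _, min_le_right _ _]
  rw [W, Jhat_of_mem hzL, ← EReal.coe_add] at hle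
  rw [← hzu] at hle ⊢
  exact_mod_cast hle

theorem potential_add_nonneg (hB : BarrierAssumption p₀ r J B uStar) {q : ℝ} (hq : q ∈ modes)
    {u : Plane} (hu : u ∈ region p₀ r q) : 0 ≤ potential J B q u + J uStar := by
  by_cases h : u = uStar
  · rw [h, (hB.uStar_mem_region_and hq).2]
  · exact (hB.potential_add_pos hq hu h).le

theorem J_uStar_nonpos (hB : BarrierAssumption p₀ r J B uStar) : J uStar ≤ 0 := by
  have hq : (1 : ℝ) ∈ modes := Or.inl rfl
  obtain ⟨h1, h2⟩ := hB.uStar_mem_region_and hq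
  linarith [hB.potential_nonneg hq h1]

end BarrierAssumption

/-! ### Sublevel sets of the Lyapunov function -/

/-- The Lyapunov function `V(û, q) = Ĵ_q(û) + J(u⋆)` where it is finite. -/
def lyapunov (J : Plane → ℝ) (B : ℝ → Plane → ℝ) (uStar : Plane) (x : Plane × ℝ) : ℝ :=
  potential J B x.2 x.1 + J uStar

/-- The states at which the Lyapunov function is finite and at most `c`. -/
def sublevel (p₀ : Plane) (r : ℝ) (J : Plane → ℝ) (B : ℝ → Plane → ℝ) (uStar : Plane) (c : ℝ) :
    Set (Plane × ℝ) :=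
  {x | x.2 ∈ modes ∧ x.1 ∈ region p₀ r x.2 ∧ lyapunov J B uStar x ≤ c}

section Sublevel

variable {p₀ uStar : Plane} {r : ℝ} {J : Plane → ℝ} {B : ℝ → Plane → ℝ}

theorem sublevel_subset (c : ℝ) : sublevel p₀ r J B uStar c ⊆ freeSpace p₀ r ×ˢ modes :=
  fun _ hx => ⟨region_subset_freeSpace _ hx.2.1, hx.1⟩

theorem sublevel_mono {c d : ℝ} (h : c ≤ d) :
    sublevel p₀ r J B uStar c ⊆ sublevel p₀ r J B uStar d :=
  fun _ hx => ⟨hx.1, hx.2.1, hx.2.2.trans h⟩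

theorem slice_sublevel (q : ℝ) (c : ℝ) (hq : q ∈ modes) (u : Plane) :
    (u, q) ∈ sublevel p₀ r J B uStar c ↔ Jhat p₀ r J B q u ≤ ((c - J uStar : ℝ) : EReal) := by
  constructor
  · rintro ⟨-, h1, h2⟩
    have h2 : potential J B q u + J uStar ≤ c := h2
    rw [Jhat_of_mem h1, EReal.coe_le_coe_iff]
    linarith
  · intro h
    have h1 := mem_region_of_Jhat_lt_top (lt_of_le_of_lt h (EReal.coe_lt_top _))
    rw [Jhat_of_mem h1, EReal.coe_le_coe_iff] at h
    refine ⟨hq, h1, ?_⟩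
    change potential J B q u + J uStar ≤ c
    linarith

theorem isCompact_sublevel (hB : BarrierAssumption p₀ r J B uStar) (c : ℝ) :
    IsCompact (sublevel p₀ r J B uStar c) := by
  have h1 : (1 : ℝ) ∈ modes := Or.inl rfl
  have h2 : (2 : ℝ) ∈ modes := Or.inr rfl
  have heq : sublevel p₀ r J B uStar c =
      {u | Jhat p₀ r J B 1 u ≤ ((c - J uStar : ℝ) : EReal)} ×ˢ {1} ∪
      {u | Jhat p₀ r J B 2 u ≤ ((c - J uStar : ℝ) : EReal)} ×ˢ {2} := by
    ext ⟨u, q⟩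
    constructor
    · intro h
      rcases modes_cases h.1 with rfl | rfl
      · exact Or.inl ⟨(slice_sublevel _ _ h1 u).1 h, rfl⟩
      · exact Or.inr ⟨(slice_sublevel _ _ h2 u).1 h, rfl⟩
    · rintro (⟨h, rfl⟩ | ⟨h, rfl⟩)
      · exact (slice_sublevel _ _ h1 u).2 h
      · exact (slice_sublevel _ _ h2 u).2 h
  rw [heq]
  exact ((hB.isCompact_Jhat_le h1 _).prod isCompact_singleton).union
    ((hB.isCompact_Jhat_le h2 _).prod isCompact_singleton)

theorem sublevel_zero_subset (hB : BarrierAssumption p₀ r J B uStar) :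
    sublevel p₀ r J B uStar 0 ⊆ {uStar} ×ˢ modes := by
  rintro x ⟨h1, h2, h3⟩
  refine ⟨?_, h1⟩
  by_contra h
  exact absurd h3 (not_le.2 (hB.potential_add_pos h1 h2 h))

/-- Small sublevel sets lie in every neighbourhood of the target set. -/
theorem exists_sublevel_subset (hB : BarrierAssumption p₀ r J B uStar) {O : Set (Plane × ℝ)}
    (hO : IsOpen O) (hA : {uStar} ×ˢ modes ⊆ O) :
    ∃ a, 0 < a ∧ sublevel p₀ r J B uStar a ⊆ O := by
  by_contra! hne
  -- Points of shrinking sublevel sets outside `O` would accumulate, by compactness, at a point with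
  -- `V ≤ 0`, that is, in the target set, which lies inside `O`.
  choose x hx hxO using fun n : ℕ => not_subset.1 (hne (1 / ((n : ℝ) + 1)) (by positivity))
  have hle : ∀ n m : ℕ, n ≤ m → x m ∈ sublevel p₀ r J B uStar (1 / ((n : ℝ) + 1)) :=
    fun n m hnm => sublevel_mono (one_div_le_one_div_of_le (by positivity)
      (by exact_mod_cast Nat.succ_le_succ hnm)) (hx m)
  obtain ⟨y, -, σ, hσ, hlim⟩ := (isCompact_sublevel hB (1 / ((0 : ℕ) + 1))).tendsto_subseq
    (fun n => hle 0 n (Nat.zero_le n))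
  have hy : ∀ n : ℕ, y ∈ sublevel p₀ r J B uStar (1 / ((n : ℝ) + 1)) := fun n =>
    (isCompact_sublevel hB _).isClosed.mem_of_tendsto hlim (by
      filter_upwards [eventually_ge_atTop n] with m hm
      exact hle n _ (hm.trans (hσ.id_le m)))
  have hy0 : y ∈ sublevel p₀ r J B uStar 0 :=
    ⟨(hy 0).1, (hy 0).2.1, ge_of_tendsto' tendsto_one_div_add_atTop_nhds_zero_nat
      fun n => (hy n).2.2⟩
  have hyO := hO.mem_nhds (hA (sublevel_zero_subset hB hy0))
  obtain ⟨n, hn⟩ := (hlim.eventually hyO).exists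
  exact hxO _ hn

/-- Away from the target set the gradients are bounded below on sublevel sets. -/
theorem exists_gradient_lower_bound (hB : BarrierAssumption p₀ r J B uStar) {a : ℝ} (ha : 0 < a)
    (b : ℝ) : ∃ δ, 0 < δ ∧ ∀ q ∈ modes, ∀ u ∈ region p₀ r q, a ≤ potential J B q u + J uStar →
      potential J B q u + J uStar ≤ b → δ ≤ ‖gradient (potential J B q) u‖ ^ 2 := by
  have key : ∀ q ∈ modes, ∃ δ, 0 < δ ∧ ∀ u ∈ region p₀ r q, a ≤ potential J B q u + J uStar →
      potential J B q u + J uStar ≤ b → δ ≤ ‖gradient (potential J B q) u‖ ^ 2 := by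
    intro q hq
    -- The function `ϱ` need not be continuous, so it only serves to show that the gradient does not
    -- vanish on this compact shell; the uniform bound is the minimum of the continuous squared
    -- norm.
    set K := {u | Jhat p₀ r J B q u ≤ ((b - J uStar : ℝ) : EReal)} ∩
      {u | ((a - J uStar : ℝ) : EReal) ≤ Jhat p₀ r J B q u} with hK
    have hKc : IsCompact K := (hB.isCompact_Jhat_le hq _).inter_right
      (isClosed_le continuous_const (hB.continuous_Jhat hq))
    have hKL : K ⊆ region p₀ r q := fun u hu =>
      mem_region_of_Jhat_lt_top (lt_of_le_of_lt hu.1 (EReal.coe_lt_top _))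
    have hgc : ContinuousOn (fun u => ‖gradient (potential J B q) u‖ ^ 2) K := by
      have h1 := (hB.contDiffOn q hq).continuousOn_fderiv_of_isOpen (isOpen_region q) le_rfl
      exact (((InnerProductSpace.toDual ℝ Plane).symm.continuous.comp_continuousOn h1).norm.pow
        2).mono hKL
    have hmemK : ∀ u ∈ region p₀ r q, a ≤ potential J B q u + J uStar →
        potential J B q u + J uStar ≤ b → u ∈ K := by
      intro u hu h1 h2
      constructor
      · change Jhat p₀ r J B q u ≤ _
        rw [Jhat_of_mem hu, EReal.coe_le_coe_iff]
        linarith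
      · change _ ≤ Jhat p₀ r J B q u
        rw [Jhat_of_mem hu, EReal.coe_le_coe_iff]
        linarith
    rcases K.eq_empty_or_nonempty with he | hne
    · exact ⟨1, one_pos, fun u hu h1 h2 => absurd (hmemK u hu h1 h2) (by simp [he])⟩
    obtain ⟨z, hz, hmin⟩ := hKc.exists_isMinOn hne hgc
    refine ⟨_, ?_, fun u hu h1 h2 => hmin (hmemK u hu h1 h2)⟩
    have hpos : 0 < potential J B q z + J uStar := by
      have h3 := hz.2
      change _ ≤ Jhat p₀ r J B q z at h3
      rw [Jhat_of_mem (hKL hz), EReal.coe_le_coe_iff] at h3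
      linarith
    have := norm_pos_iff.2 (hB.gradient_ne_zero hq (hKL hz) hpos)
    positivity
  obtain ⟨δ₁, hδ₁, h1⟩ := key 1 (Or.inl rfl)
  obtain ⟨δ₂, hδ₂, h2⟩ := key 2 (Or.inr rfl)
  refine ⟨min δ₁ δ₂, lt_min hδ₁ hδ₂, fun q hq u hu ha hb => ?_⟩
  rcases modes_cases hq with rfl | rfl
  · exact (min_le_left _ _).trans (h1 u hu ha hb)
  · exact (min_le_right _ _).trans (h2 u hu ha hb)

end Sublevel


variable {p₀ uStar : Plane} {r : ℝ} {J : Plane → ℝ} {B : ℝ → Plane → ℝ} {χ l : ℝ}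

/-! ### Flow and jump sets -/

section Sets

theorem BarrierAssumption.continuous_const_mul_Jhat (hB : BarrierAssumption p₀ r J B uStar)
    {q : ℝ} (hq : q ∈ modes) {μ : ℝ} (hμ : 0 < μ) :
    Continuous fun u => (μ : EReal) * Jhat p₀ r J B q u := by
  rw [continuous_iff_continuousAt]
  intro u
  have hne : (μ : EReal) ≠ 0 := by exact_mod_cast hμ.ne'
  have h1 : ContinuousAt (fun p : EReal × EReal => p.1 * p.2) ((μ : EReal), Jhat p₀ r J B q u) :=
    EReal.continuousAt_mul (Or.inl hne) (Or.inl hne) (Or.inl (EReal.coe_ne_bot μ))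
      (Or.inl (EReal.coe_ne_top μ))
  exact ContinuousAt.comp (f := fun u => ((μ : EReal), Jhat p₀ r J B q u)) h1
    (continuousAt_const.prodMk (hB.continuous_Jhat hq).continuousAt)

theorem isClosed_of_slices {S : Set (Plane × ℝ)} (hS : ∀ x ∈ S, x.2 ∈ modes)
    (h : ∀ q ∈ modes, IsClosed {u | (u, q) ∈ S}) : IsClosed S := by
  have heq : S = {u | (u, (1 : ℝ)) ∈ S} ×ˢ {1} ∪ {u | (u, (2 : ℝ)) ∈ S} ×ˢ {2} := by
    ext ⟨u, q⟩
    constructor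
    · intro hx
      rcases modes_cases (hS _ hx) with h | h
      · obtain rfl : q = 1 := h
        exact Or.inl ⟨hx, rfl⟩
      · obtain rfl : q = 2 := h
        exact Or.inr ⟨hx, rfl⟩
    · rintro (⟨h, rfl⟩ | ⟨h, rfl⟩) <;> exact h
  rw [heq]
  exact ((h 1 (Or.inl rfl)).prod isClosed_singleton).union
    ((h 2 (Or.inr rfl)).prod isClosed_singleton)

theorem isClosed_flowSet (hB : BarrierAssumption p₀ r J B uStar) (hχ : 0 < χ) :
    IsClosed (dynamics p₀ r J B χ l).C := by
  refine isClosed_of_slices (fun x hx => hx.2.1) fun q hq => ?_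
  have heq : {u | (u, q) ∈ (dynamics p₀ r J B χ l).C} = closure (freeSpace p₀ r) ∩
      {u | Jhat p₀ r J B q u ≤ (χ : EReal) * Jhat p₀ r J B (3 - q) u} := by
    ext u
    exact ⟨fun h => ⟨h.1, h.2.2⟩, fun h => ⟨h.1, hq, h.2⟩⟩
  rw [heq]
  exact isClosed_closure.inter (isClosed_le (hB.continuous_Jhat hq)
    (hB.continuous_const_mul_Jhat (three_sub_mem_modes hq) hχ))

theorem isClosed_jumpSet (hB : BarrierAssumption p₀ r J B uStar) (hμ : 0 < χ - l) :
    IsClosed (dynamics p₀ r J B χ l).D := by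
  refine isClosed_of_slices (fun x hx => hx.2.1) fun q hq => ?_
  have heq : {u | (u, q) ∈ (dynamics p₀ r J B χ l).D} = closure (freeSpace p₀ r) ∩
      {u | ((χ - l : ℝ) : EReal) * Jhat p₀ r J B (3 - q) u ≤ Jhat p₀ r J B q u} := by
    ext u
    exact ⟨fun h => ⟨h.1, h.2.2⟩, fun h => ⟨h.1, hq, h.2⟩⟩
  rw [heq]
  exact isClosed_closure.inter (isClosed_le
    (hB.continuous_const_mul_Jhat (three_sub_mem_modes hq) hμ) (hB.continuous_Jhat hq))

/-- Outside `𝓛_q` a point of `𝒰` lies in the other region, so the flow condition would read `∞ ≤ χ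
Ĵ_{3-q} < ∞`. -/
theorem mem_region_of_mem_flowSet {x : Plane × ℝ} (hx : x ∈ (dynamics p₀ r J B χ l).C)
    (hU : x.1 ∈ freeSpace p₀ r) : x.1 ∈ region p₀ r x.2 := by
  by_contra h
  have h3 := (mem_region_or hx.2.1 hU).resolve_left h
  have h4 := hx.2.2
  rw [Jhat_of_notMem h, Jhat_of_mem h3, ← EReal.coe_mul, top_le_iff] at h4
  exact EReal.coe_ne_top _ h4

theorem mem_region_of_mem_jumpSet (hμ : 0 < χ - l) {x : Plane × ℝ}
    (hx : x ∈ (dynamics p₀ r J B χ l).D) (hU : x.1 ∈ freeSpace p₀ r) :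
    x.1 ∈ region p₀ r (3 - x.2) := by
  by_contra h
  have h3 := (mem_region_or hx.2.1 hU).resolve_right h
  have h4 := hx.2.2
  rw [Jhat_of_notMem h, Jhat_of_mem h3, EReal.coe_mul_top_of_pos hμ, top_le_iff] at h4
  exact EReal.coe_ne_top _ h4

/-- The shift by `J(u⋆)` is harmless in the jump inequality because `(χ - l) J(u⋆) ≤ J(u⋆)`, as
`J(u⋆) ≤ 0`. -/
theorem lyapunov_jump (hB : BarrierAssumption p₀ r J B uStar) (hμ : 1 < χ - l) {x : Plane × ℝ}
    (hx : x ∈ (dynamics p₀ r J B χ l).D) (hL : x.1 ∈ region p₀ r x.2) :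
    (χ - l) * lyapunov J B uStar (x.1, 3 - x.2) ≤ lyapunov J B uStar x := by
  have h3 := mem_region_of_mem_jumpSet (by linarith) hx (region_subset_freeSpace _ hL)
  have h4 := hx.2.2
  rw [Jhat_of_mem h3, Jhat_of_mem hL, ← EReal.coe_mul, EReal.coe_le_coe_iff] at h4
  have h5 := hB.J_uStar_nonpos
  change (χ - l) * (potential J B (3 - x.2) x.1 + J uStar) ≤ potential J B x.2 x.1 + J uStar
  nlinarith

/-- Compact sets of states with finite potential lie in a sublevel set. -/
theorem exists_subset_sublevel (hB : BarrierAssumption p₀ r J B uStar) {K : Set (Plane × ℝ)}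
    (hK : IsCompact K) (hKL : ∀ x ∈ K, x.2 ∈ modes ∧ x.1 ∈ region p₀ r x.2) :
    ∃ b, K ⊆ sublevel p₀ r J B uStar b := by
  have key : ∀ q ∈ modes, ∃ b, ∀ x ∈ K, x.2 = q → potential J B q x.1 ≤ b := by
    intro q hq
    have hc : IsCompact (Prod.fst '' (K ∩ Prod.snd ⁻¹' {q})) :=
      (hK.inter_right (isClosed_singleton.preimage continuous_snd)).image continuous_fst
    have hsub : Prod.fst '' (K ∩ Prod.snd ⁻¹' {q}) ⊆ region p₀ r q := by
      rintro _ ⟨x, ⟨hx, rfl⟩, rfl⟩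
      exact (hKL x hx).2
    obtain ⟨b, hb⟩ := hc.bddAbove_image ((hB.contDiffOn q hq).continuousOn.mono hsub)
    exact ⟨b, fun x hx hxq => hb ⟨x.1, ⟨x, ⟨hx, hxq⟩, rfl⟩, rfl⟩⟩
  obtain ⟨b₁, h1⟩ := key 1 (Or.inl rfl)
  obtain ⟨b₂, h2⟩ := key 2 (Or.inr rfl)
  refine ⟨max b₁ b₂ + J uStar, fun x hx => ⟨(hKL x hx).1, (hKL x hx).2, ?_⟩⟩
  refine add_le_add_left ?_ _
  rcases modes_cases (hKL x hx).1 with h | h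
  · rw [h]
    exact (h1 x hx h).trans (le_max_left _ _)
  · rw [h]
    exact (h2 x hx h).trans (le_max_right _ _)

/-- Over a compact set of initial states, the Lyapunov function is bounded once a solution has
flowed or jumped. -/
theorem exists_uniform_sublevel (hB : BarrierAssumption p₀ r J B uStar) (hχ : 0 < χ)
    (hμ : 0 < χ - l) {K : Set (Plane × ℝ)} (hK : IsCompact K)
    (hKU : K ⊆ freeSpace p₀ r ×ˢ modes) :
    ∃ b, ∀ x ∈ K,
      (x ∈ (dynamics p₀ r J B χ l).C → x ∈ sublevel p₀ r J B uStar b) ∧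
      (x ∈ (dynamics p₀ r J B χ l).D → (x.1, 3 - x.2) ∈ sublevel p₀ r J B uStar b) := by
  obtain ⟨b₁, h1⟩ := exists_subset_sublevel hB
    (hK.inter_right (isClosed_flowSet (l := l) hB hχ))
    fun x hx => ⟨hx.2.2.1, mem_region_of_mem_flowSet hx.2 (hKU hx.1).1⟩
  have hcont : Continuous fun x : Plane × ℝ => (x.1, 3 - x.2) := by fun_prop
  obtain ⟨b₂, h2⟩ := exists_subset_sublevel hB
    ((hK.inter_right (isClosed_jumpSet hB hμ)).image hcont) (by
      rintro _ ⟨x, hx, rfl⟩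
      exact ⟨three_sub_mem_modes hx.2.2.1, mem_region_of_mem_jumpSet hμ hx.2 (hKU hx.1).1⟩)
  exact ⟨max b₁ b₂, fun x hx => ⟨fun h => sublevel_mono (le_max_left _ _) (h1 ⟨hx, h⟩),
    fun h => sublevel_mono (le_max_right _ _) (h2 ⟨x, ⟨hx, h⟩, rfl⟩)⟩⟩

end Sets

/-! ### Lyapunov estimates along solutions -/

section Solutions

/-- The start is only assumed to lie in `𝒰 × 𝒬`; that it lies in the flow set, so that its potential
is finite, is part of the conclusion. -/
theorem flow_step (hB : BarrierAssumption p₀ r J B uStar) (hχ : 0 < χ)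
    {x : HybridArc (Plane × ℝ)}
    (hx : ((dynamics p₀ r J B χ l).target (gradJhat p₀ r J B)).IsSolution x)
    {s t : ℝ} {j : ℕ} (hs : (s, j) ∈ x.dom) (ht : (t, j) ∈ x.dom) (hst : s < t)
    (hU : x.val s j ∈ freeSpace p₀ r ×ˢ modes) :
    x.val s j ∈ (dynamics p₀ r J B χ l).C ∧
    x.val t j ∈ sublevel p₀ r J B uStar (lyapunov J B uStar (x.val s j)) ∧
    ∀ δ m M, (∀ q ∈ modes, ∀ u ∈ region p₀ r q, m ≤ potential J B q u + J uStar →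
        potential J B q u + J uStar ≤ M → δ ≤ ‖gradient (potential J B q) u‖ ^ 2) →
      lyapunov J B uStar (x.val s j) ≤ M →
      lyapunov J B uStar (x.val t j) ≤
        max m (lyapunov J B uStar (x.val s j) - δ * (t - s)) := by
  have hsub := x.isHybridTimeDomain.Icc_subset hs ht
  have hac : AbsolutelyContinuousOnInterval (fun τ => x.val τ j) s t :=
    x.locallyAC j ⟨(s + t) / 2, mem_interior.2 ⟨Ioo s t, Ioo_subset_Icc_self.trans hsub,
      isOpen_Ioo, by constructor <;> linarith⟩⟩ s t hst.le hs ht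
  have hflow : ∀ᵐ τ, τ ∈ Icc s t → x.val τ j ∈ (dynamics p₀ r J B χ l).C ∧
      ∃ v ∈ {v | ∃ ξ ∈ gradJhat p₀ r J B (x.val τ j), v = ((-ξ, 0) : Plane × ℝ)},
        HasDerivAt (fun τ => x.val τ j) v τ := by
    rw [← ae_restrict_iff' measurableSet_Icc]
    exact ae_mono (Measure.restrict_mono hsub le_rfl) (hx.flow j)
  have huIcc : uIcc s t = Icc s t := uIcc_of_le hst.le
  have hcont : ContinuousOn (fun τ => x.val τ j) (Icc s t) := huIcc ▸ hac.continuousOn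
  have hsI : s ∈ Icc s t := ⟨le_rfl, hst.le⟩
  have htI : t ∈ Icc s t := ⟨hst.le, le_rfl⟩
  have hC : x.val s j ∈ (dynamics p₀ r J B χ l).C := by
    -- The flow condition holds only almost everywhere, hence on a dense set of times; closedness of
    -- `C` and continuity carry it to the initial time `s`.
    have hdense := Measure.dense_of_ae hflow
    have hcl : s ∈ closure (Ioo s t ∩ {τ | τ ∈ Icc s t → x.val τ j ∈ (dynamics p₀ r J B χ l).C ∧
        ∃ v ∈ {v | ∃ ξ ∈ gradJhat p₀ r J B (x.val τ j), v = ((-ξ, 0) : Plane × ℝ)},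
          HasDerivAt (fun τ => x.val τ j) v τ}) := by
      have h1 := closure_mono (hdense.open_subset_closure_inter (isOpen_Ioo (a := s) (b := t)))
      rw [closure_closure, closure_Ioo hst.ne] at h1
      exact h1 hsI
    have h2 := ((hcont s hsI).mono (fun τ hτ => Ioo_subset_Icc_self hτ.1 :
      _ ⊆ Icc s t)).mem_closure hcl (fun τ hτ => (hτ.2 (Ioo_subset_Icc_self hτ.1)).1)
    rwa [(isClosed_flowSet hB hχ).closure_eq] at h2
  obtain ⟨q, hq⟩ := (hac.comp_lipschitz LipschitzWith.prod_snd).const_of_ae_hasDerivAt_zero (by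
    filter_upwards [hflow] with τ hτ hmem
    obtain ⟨-, v, ⟨ξ, -, rfl⟩, hder⟩ := hτ (huIcc ▸ hmem)
    exact hder.snd)
  rw [huIcc] at hq
  have hqs : (x.val s j).2 = q := hq s hsI
  have hqt : (x.val t j).2 = q := hq t htI
  have hqm : q ∈ modes := hqs ▸ hU.2
  have hL : (x.val s j).1 ∈ region p₀ r q := hqs ▸ mem_region_of_mem_flowSet hC hU.1
  have hac1 := hac.comp_lipschitz LipschitzWith.prod_fst
  have hd : ∀ᵐ τ, τ ∈ Icc s t → HasDerivAt (fun τ => (x.val τ j).1)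
      (-gradient (potential J B q) (x.val τ j).1) τ := by
    filter_upwards [hflow] with τ hτ hmem
    obtain ⟨-, v, ⟨ξ, hξ, rfl⟩, hder⟩ := hτ hmem
    have h3 := hξ.2
    rw [show (x.val τ j).2 = q from hq τ hmem] at h3
    rw [h3.gradient]
    exact hder.fst
  have hcd := hB.contDiffOn q hqm
  have hmem := mem_of_descent (isOpen_region q) hcd (hB.continuous_Jhat hqm)
    (fun v hv => Jhat_of_mem hv) (fun v hv => Jhat_of_notMem hv) hst.le hac1 hd hL
  have hanti := potential_le_of_descent (isOpen_region q) hcd hst.le hac1 hd hmem hsI htI hst.le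
  simp only at hanti
  refine ⟨hC, ⟨hqt ▸ hqm, hqt ▸ hmem t htI, ?_⟩, fun δ m M hδ hM => ?_⟩
  · unfold lyapunov
    rw [hqs, hqt]
    linarith
  · unfold lyapunov at hM ⊢
    rw [hqs] at hM ⊢
    rw [hqt]
    have h4 := potential_decay_of_descent (isOpen_region q) hcd hst.le hac1 hd hmem
      (δ := δ) (m := m - J uStar) (M := M - J uStar)
      (fun v hv h1 h2 => hδ q hqm v hv (by linarith) (by linarith)) (by linarith)
    rcases le_max_iff.1 h4 with h5 | h5
    · exact le_max_of_le_left (by linarith)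
    · exact le_max_of_le_right (by linarith)

theorem jump_step (hμ : 0 < χ - l) {x : HybridArc (Plane × ℝ)}
    (hx : ((dynamics p₀ r J B χ l).target (gradJhat p₀ r J B)).IsSolution x)
    {t : ℝ} {j : ℕ} (h1 : (t, j) ∈ x.dom) (h2 : (t, j + 1) ∈ x.dom)
    (hU : x.val t j ∈ freeSpace p₀ r ×ˢ modes) :
    x.val t j ∈ (dynamics p₀ r J B χ l).D ∧
      x.val t (j + 1) = ((x.val t j).1, 3 - (x.val t j).2) ∧
      (x.val t (j + 1)).2 ∈ modes ∧
      (x.val t (j + 1)).1 ∈ region p₀ r (x.val t (j + 1)).2 := by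
  obtain ⟨hD, hG⟩ := hx.jump t j h1 h2
  have hG' : x.val t (j + 1) = ((x.val t j).1, 3 - (x.val t j).2) := hG
  refine ⟨hD, hG', ?_⟩
  rw [hG']
  exact ⟨three_sub_mem_modes hU.2, mem_region_of_mem_jumpSet hμ hD hU.1⟩

/-- Sublevel sets of the Lyapunov function are forward invariant. -/
theorem sublevel_invariant (hB : BarrierAssumption p₀ r J B uStar) (hχ : 0 < χ)
    (hμ : 1 < χ - l) {x : HybridArc (Plane × ℝ)}
    (hx : ((dynamics p₀ r J B χ l).target (gradJhat p₀ r J B)).IsSolution x) {b : ℝ}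
    (h0 : x.val 0 0 ∈ sublevel p₀ r J B uStar b) :
    ∀ t j, (t, j) ∈ x.dom → x.val t j ∈ sublevel p₀ r J B uStar b := by
  refine x.isHybridTimeDomain.induction h0 ?_ ?_
  · intro s t j hs ht hst h
    exact sublevel_mono h.2.2 (flow_step hB hχ hx hs ht hst (sublevel_subset _ h)).2.1
  · intro t j h1 h2 h
    obtain ⟨hD, hG, hm, hL⟩ := jump_step (by linarith) hx h1 h2 (sublevel_subset _ h)
    refine ⟨hm, hL, ?_⟩
    have h3 := lyapunov_jump hB hμ hD h.2.1
    rw [← hG] at h3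
    -- Since `V⁺ ≥ 0` and `χ - l > 1`, one has `V⁺ ≤ (χ - l) V⁺ ≤ V`.
    have h4 : 0 ≤ lyapunov J B uStar (x.val t (j + 1)) := hB.potential_add_nonneg hm hL
    nlinarith [h.2.2]

/-- The Lyapunov function decreases linearly in `t + j` as long as it is above `a`. -/
theorem sublevel_decay (hB : BarrierAssumption p₀ r J B uStar) (hχ : 0 < χ)
    (hμ : 1 < χ - l) {x : HybridArc (Plane × ℝ)}
    (hx : ((dynamics p₀ r J B χ l).target (gradJhat p₀ r J B)).IsSolution x) {a b δ : ℝ}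
    (hU : x.val 0 0 ∈ freeSpace p₀ r ×ˢ modes)
    (hC : x.val 0 0 ∈ (dynamics p₀ r J B χ l).C → x.val 0 0 ∈ sublevel p₀ r J B uStar b)
    (hD : x.val 0 0 ∈ (dynamics p₀ r J B χ l).D →
      ((x.val 0 0).1, 3 - (x.val 0 0).2) ∈ sublevel p₀ r J B uStar b)
    (hδ0 : 0 ≤ δ) (hδ1 : δ ≤ 1) (hδμ : δ ≤ (χ - l - 1) * a)
    (hgrad : ∀ q ∈ modes, ∀ u ∈ region p₀ r q, a ≤ potential J B q u + J uStar →
        potential J B q u + J uStar ≤ max a (b + 1) →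
        δ ≤ ‖gradient (potential J B q) u‖ ^ 2) :
    ∀ t j, (t, j) ∈ x.dom → (t = 0 ∧ j = 0) ∨
      x.val t j ∈ sublevel p₀ r J B uStar (max a (b + δ - δ * (t + j))) := by
  -- The initial instant is a separate alternative because `V` may be infinite there.
  refine x.isHybridTimeDomain.induction (Or.inl ⟨rfl, rfl⟩) ?_ ?_
  · rintro s t j hs ht hst (⟨rfl, rfl⟩ | h)
    · right
      obtain ⟨h1, h2, h3⟩ := flow_step hB hχ hx hs ht hst hU
      have h4 := (hC h1).2.2
      refine ⟨h2.1, h2.2.1, (h3 δ a _ hgrad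
        (h4.trans ((le_add_of_nonneg_right zero_le_one).trans (le_max_right _ _)))).trans ?_⟩
      refine max_le_max le_rfl ?_
      push_cast
      linarith
    · right
      obtain ⟨h1, h2, h3⟩ := flow_step hB hχ hx hs ht hst (sublevel_subset _ h)
      have h4 := h.2.2
      have hs0 := x.isHybridTimeDomain.nonneg _ _ hs
      have h5 : 0 ≤ δ * (s + j) := by positivity
      refine ⟨h2.1, h2.2.1, (h3 δ a _ hgrad
        (h4.trans (max_le_max le_rfl (by linarith)))).trans ?_⟩
      refine max_le (le_max_left _ _) ?_
      rcases le_max_iff.1 h4 with h6 | h6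
      · exact le_max_of_le_left (by nlinarith)
      · exact le_max_of_le_right (by linarith)
  · rintro t j h1 h2 (⟨rfl, rfl⟩ | h)
    · right
      obtain ⟨h3, h4, -⟩ := jump_step (by linarith) hx h1 h2 hU
      rw [h4]
      -- After a jump at time zero only `V ≤ b` is known; the extra `δ` in the bound cancels `δ * (0
      -- + 1)`.
      refine sublevel_mono (le_max_of_le_right ?_) (hD h3)
      push_cast
      linarith
    · right
      obtain ⟨h3, h4, hm, hL⟩ := jump_step (by linarith) hx h1 h2 (sublevel_subset _ h)
      refine ⟨hm, hL, ?_⟩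
      have h5 := lyapunov_jump hB hμ h3 h.2.1
      rw [← h4] at h5
      have h6 : 0 ≤ lyapunov J B uStar (x.val t (j + 1)) := hB.potential_add_nonneg hm hL
      by_contra! hlt
      obtain ⟨ha, hb⟩ := max_lt_iff.1 hlt
      push_cast at hb
      -- If `V⁺ > a`, the jump lowers `V` by at least `(χ - l - 1) V⁺ ≥ (χ - l - 1) a ≥ δ`, the
      -- decrease required for one unit of `j`.
      have h7 : (χ - l - 1) * a ≤ (χ - l - 1) * lyapunov J B uStar (x.val t (j + 1)) :=
        mul_le_mul_of_nonneg_left ha.le (by linarith)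
      rcases le_max_iff.1 h.2.2 with h8 | h8 <;> nlinarith

end Solutions

end SourceSeeking

/-- Growth at infinity places the set inside a compact one; growth at boundary points outside `S`
makes it closed in the whole space. -/
theorem IsProperIndicator.isCompact_le {X : Type*} [TopologicalSpace X]
    {ω : X → ℝ≥0} {A S : Set X} (hω : IsProperIndicator ω A S) (R : ℝ≥0) :
    IsCompact {x | x ∈ S ∧ ω x ≤ R} := by
  have h1 := hω.tendsto_infty.eventually (eventually_gt_atTop R)
  rw [eventually_inf_principal] at h1
  obtain ⟨K, hK, hKs⟩ := mem_cocompact.1 h1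
  refine hK.of_isClosed_subset (isClosed_of_closure_subset fun z hz => ?_) ?_
  · have hne : NeBot (𝓝[{x | x ∈ S ∧ ω x ≤ R}] z) := mem_closure_iff_nhdsWithin_neBot.1 hz
    have hle : 𝓝[{x | x ∈ S ∧ ω x ≤ R}] z ≤ 𝓝[S] z := nhdsWithin_mono z fun x hx => hx.1
    have hev : ∀ᶠ x in 𝓝[{x | x ∈ S ∧ ω x ≤ R}] z, ω x ≤ R := by
      filter_upwards [self_mem_nhdsWithin] with x hx using hx.2
    by_cases hzS : z ∈ S
    · exact ⟨hzS, le_of_tendsto ((hω.continuousOn z hzS).mono_left hle) hev⟩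
    · have h2 := ((hω.tendsto_boundary z ⟨closure_mono (fun x hx => hx.1) hz, hzS⟩).mono_left
        hle).eventually (eventually_gt_atTop R)
      obtain ⟨x, hx1, hx2⟩ := (h2.and hev).exists
      exact absurd hx1 (not_lt.2 hx2)
  · intro x hx
    by_contra h
    exact absurd (hKs h hx.1) (not_lt.2 hx.2)

/-! ### Uniform attraction and the `𝒦ℒ` bound -/

namespace SourceSeeking

variable {p₀ uStar : Plane} {r : ℝ} {J : Plane → ℝ} {B : ℝ → Plane → ℝ} {χ l : ℝ}

/-- Solutions from a compact set of initial states are uniformly bounded. -/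
theorem exists_uniform_bound (hB : BarrierAssumption p₀ r J B uStar) (hχ : 0 < χ)
    (hμ : 1 < χ - l) {K : Set (Plane × ℝ)} (hK : IsCompact K)
    (hKU : K ⊆ freeSpace p₀ r ×ˢ modes) :
    ∃ c, ∀ x : HybridArc (Plane × ℝ),
      ((dynamics p₀ r J B χ l).target (gradJhat p₀ r J B)).IsSolution x → x.val 0 0 ∈ K →
      ∀ t j, (t, j) ∈ x.dom → (t = 0 ∧ j = 0) ∨ x.val t j ∈ sublevel p₀ r J B uStar c := by
  obtain ⟨b, hb⟩ := exists_uniform_sublevel (l := l) hB hχ (by linarith) hK hKU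
  refine ⟨max 0 b, fun x hx h0 => ?_⟩
  -- With `a = δ = 0` the decay estimate degenerates to boundedness and the gradient condition is
  -- trivial.
  have := sublevel_decay (a := 0) (b := b) (δ := 0) hB hχ hμ hx (hKU h0) (hb _ h0).1 (hb _ h0).2
    le_rfl zero_le_one (by simp) (fun _ _ _ _ _ _ => by positivity)
  simpa using this

/-- Solutions from a compact set of initial states reach every sublevel set in uniform time. -/
theorem exists_uniform_time (hB : BarrierAssumption p₀ r J B uStar) (hχ : 0 < χ)
    (hμ : 1 < χ - l) {K : Set (Plane × ℝ)} (hK : IsCompact K)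
    (hKU : K ⊆ freeSpace p₀ r ×ˢ modes) {a : ℝ} (ha : 0 < a) :
    ∃ T : ℝ, 0 < T ∧ ∀ x : HybridArc (Plane × ℝ),
      ((dynamics p₀ r J B χ l).target (gradJhat p₀ r J B)).IsSolution x → x.val 0 0 ∈ K →
      ∀ (t : ℝ) (j : ℕ), (t, j) ∈ x.dom → T ≤ t + j →
        x.val t j ∈ sublevel p₀ r J B uStar a := by
  obtain ⟨b, hb⟩ := exists_uniform_sublevel (l := l) hB hχ (by linarith) hK hKU
  obtain ⟨d, hd, hgrad⟩ := exists_gradient_lower_bound hB ha (max a (b + 1))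
  have hκ : 0 < (χ - l - 1) * a := mul_pos (by linarith) ha
  set δ := min d (min 1 ((χ - l - 1) * a)) with hδ
  have hδ0 : 0 < δ := lt_min hd (lt_min one_pos hκ)
  -- Beyond `(b + δ - a) / δ` the linear bound is below `a`; the `1` excludes the initial instant.
  refine ⟨max 1 ((b + δ - a) / δ), lt_max_of_lt_left one_pos, fun x hx h0 t j htj hT => ?_⟩
  rcases sublevel_decay hB hχ hμ hx (hKU h0) (hb _ h0).1 (hb _ h0).2 hδ0.le
    ((min_le_right _ _).trans (min_le_left _ _)) ((min_le_right _ _).trans (min_le_right _ _))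
    (fun q hq u hu h1 h2 => (min_le_left _ _).trans (hgrad q hq u hu h1 h2)) t j htj with h | h
  · obtain ⟨rfl, rfl⟩ := h
    have := (le_max_left _ _).trans hT
    norm_num at this
  · refine sublevel_mono (max_le le_rfl ?_) h
    have h3 := (div_le_iff₀ hδ0).1 ((le_max_right _ _).trans hT)
    linarith

theorem invariant_freeSpace (hB : BarrierAssumption p₀ r J B uStar) (hχ : 0 < χ)
    (hμ : 1 < χ - l) {x : HybridArc (Plane × ℝ)}
    (hx : ((dynamics p₀ r J B χ l).target (gradJhat p₀ r J B)).IsSolution x)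
    (h0 : x.val 0 0 ∈ freeSpace p₀ r ×ˢ modes) {t : ℝ} {j : ℕ} (htj : (t, j) ∈ x.dom) :
    x.val t j ∈ freeSpace p₀ r ×ˢ modes := by
  obtain ⟨c, hc⟩ := exists_uniform_bound hB hχ hμ (isCompact_singleton (x := x.val 0 0))
    (singleton_subset_iff.2 h0)
  rcases hc x hx rfl t j htj with ⟨rfl, rfl⟩ | h
  exacts [h0, sublevel_subset _ h]

/-- Small sublevel sets lie in small sublevel sets of every proper indicator. -/
theorem exists_sublevel_indicator_lt (hB : BarrierAssumption p₀ r J B uStar)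
    {ω : Plane × ℝ → ℝ≥0}
    (hω : IsProperIndicator ω ({uStar} ×ˢ modes) (freeSpace p₀ r ×ˢ modes))
    {ε : ℝ≥0} (hε : 0 < ε) :
    ∃ a, 0 < a ∧ ∀ x ∈ sublevel p₀ r J B uStar a, ω x < ε := by
  obtain ⟨O, hO, hOeq⟩ := continuousOn_iff'.1 hω.continuousOn (Iio ε) isOpen_Iio
  have hA : {uStar} ×ˢ modes ⊆ O := fun x hx => by
    have h1 : x ∈ ω ⁻¹' Iio ε ∩ freeSpace p₀ r ×ˢ modes :=
      ⟨by simpa [(hω.eq_zero_iff x (hω.subset hx)).2 hx] using hε, hω.subset hx⟩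
    rw [hOeq] at h1
    exact h1.1
  obtain ⟨a, ha, hsub⟩ := exists_sublevel_subset hB hO hA
  refine ⟨a, ha, fun x hx => ?_⟩
  have h2 : x ∈ O ∩ freeSpace p₀ r ×ˢ modes := ⟨hsub hx, sublevel_subset _ hx⟩
  rw [← hOeq] at h2
  exact h2.1

/-- Small sublevel sets of a proper indicator lie in small sublevel sets. -/
theorem exists_indicator_le_subset (hB : BarrierAssumption p₀ r J B uStar)
    {ω : Plane × ℝ → ℝ≥0}
    (hω : IsProperIndicator ω ({uStar} ×ˢ modes) (freeSpace p₀ r ×ˢ modes))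
    {a : ℝ} (ha : 0 < a) :
    ∃ ρ : ℝ≥0, 0 < ρ ∧ ∀ x ∈ freeSpace p₀ r ×ˢ modes, ω x ≤ ρ →
      x ∈ sublevel p₀ r J B uStar a := by
  have hcl : IsClosed {x : Plane × ℝ | x.2 ∈ modes ∧
      ((a - J uStar : ℝ) : EReal) ≤ Jhat p₀ r J B x.2 x.1} := by
    refine isClosed_of_slices (fun x hx => hx.1) fun q hq => ?_
    simpa [hq] using isClosed_le continuous_const (hB.continuous_Jhat hq)
  -- The cap `ω ≤ 1` makes the part of `𝒰 × 𝒬` with `V ≥ a` compact. It misses the target set, so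
  -- `ω` has a positive minimum on it, and half of that minimum serves as `ρ`.
  have hcomp := (hω.isCompact_le 1).inter_right hcl
  set K := {x | x ∈ freeSpace p₀ r ×ˢ modes ∧ ω x ≤ 1} ∩ {x : Plane × ℝ | x.2 ∈ modes ∧
      ((a - J uStar : ℝ) : EReal) ≤ Jhat p₀ r J B x.2 x.1} with hK
  have hmem : ∀ x ∈ freeSpace p₀ r ×ˢ modes, ω x ≤ 1 → x ∉ K →
      x ∈ sublevel p₀ r J B uStar a := by
    intro x hx h1 hxK
    refine (slice_sublevel x.2 a hx.2 x.1).2 ?_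
    by_contra! h
    exact hxK ⟨⟨hx, h1⟩, hx.2, h.le⟩
  rcases K.eq_empty_or_nonempty with he | hne
  · exact ⟨1, one_pos, fun x hx h1 => hmem x hx h1 (by simp [he])⟩
  obtain ⟨z, hz, hmin⟩ := hcomp.exists_isMinOn hne (hω.continuousOn.mono fun x hx => hx.1.1)
  have hzpos : 0 < ω z := by
    rw [pos_iff_ne_zero]
    intro h0
    have hzA := (hω.eq_zero_iff z hz.1.1).1 h0
    have hzu : z.1 = uStar := hzA.1
    have h2 := hz.2.2
    obtain ⟨h3, h4⟩ := hB.uStar_mem_region_and hzA.2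
    rw [hzu, Jhat_of_mem h3, EReal.coe_le_coe_iff] at h2
    linarith
  refine ⟨min 1 (ω z / 2), lt_min one_pos (half_pos hzpos), fun x hx h1 => ?_⟩
  refine hmem x hx (h1.trans (min_le_left _ _)) fun hxK => ?_
  have h2 : ω z ≤ ω x := hmin hxK
  exact absurd (h2.trans (h1.trans (min_le_right _ _))) (not_le.2 (NNReal.half_lt_self hzpos.ne'))

/-- The values of `ω` after time `s` along solutions that start with `ω ≤ ρ`. -/
def reachedValues (H : HybridSystem (Plane × ℝ)) (S : Set (Plane × ℝ)) (ω : Plane × ℝ → ℝ≥0)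
    (ρ s : ℝ≥0) : Set ℝ≥0 :=
  {y | ∃ x : HybridArc (Plane × ℝ), H.IsSolution x ∧ x.val 0 0 ∈ S ∧ ω (x.val 0 0) ≤ ρ ∧
    ∃ (t : ℝ) (j : ℕ), (t, j) ∈ x.dom ∧ s ≤ (t + j).toNNReal ∧ ω (x.val t j) = y}

/-- The supremum of the reached values is the smallest candidate for `β` and is monotone by
construction. Uniform boundedness makes it finite, invariance of sublevel sets gives the limit as `ρ
→ 0`, and the uniform reaching time gives the limit as `s → ∞`. -/
theorem exists_KL_bound (hB : BarrierAssumption p₀ r J B uStar) (hχ : 0 < χ)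
    (hμ : 1 < χ - l) {ω : Plane × ℝ → ℝ≥0}
    (hω : IsProperIndicator ω ({uStar} ×ˢ modes) (freeSpace p₀ r ×ˢ modes)) :
    ∃ β : ℝ≥0 → ℝ≥0 → ℝ≥0, IsClassKL β ∧
      ∀ x : HybridArc (Plane × ℝ),
        ((dynamics p₀ r J B χ l).target (gradJhat p₀ r J B)).IsSolution x →
        x.val 0 0 ∈ freeSpace p₀ r ×ˢ modes →
        ∀ (t : ℝ) (j : ℕ), (t, j) ∈ x.dom →
          ω (x.val t j) ≤ β (ω (x.val 0 0)) (t + j).toNNReal := by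
  set V := reachedValues ((dynamics p₀ r J B χ l).target (gradJhat p₀ r J B))
    (freeSpace p₀ r ×ˢ modes) ω with hV
  have hbdd : ∀ ρ s, BddAbove (V ρ s) := by
    intro ρ s
    obtain ⟨c, hc⟩ := exists_uniform_bound (l := l) hB hχ hμ (hω.isCompact_le ρ)
      (fun x hx => hx.1)
    obtain ⟨M, hM⟩ := (isCompact_sublevel hB c).bddAbove_image
      (hω.continuousOn.mono (sublevel_subset c))
    refine ⟨max ρ M, ?_⟩
    rintro _ ⟨x, hx, h0, hρ, t, j, htj, -, rfl⟩
    rcases hc x hx ⟨h0, hρ⟩ t j htj with ⟨rfl, rfl⟩ | h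
    · exact hρ.trans (le_max_left _ _)
    · exact (hM ⟨_, h, rfl⟩).trans (le_max_right _ _)
  refine ⟨fun ρ s => sSup (V ρ s), ⟨fun s ρ ρ' h => ?_, fun ρ s s' h => ?_, fun s => ?_,
    fun ρ => ?_⟩, ?_⟩
  · refine csSup_le_csSup' (hbdd ρ' s) ?_
    rintro _ ⟨x, hx, h0, hρ, hrest⟩
    exact ⟨x, hx, h0, hρ.trans h, hrest⟩
  · refine csSup_le_csSup' (hbdd ρ s) ?_
    rintro _ ⟨x, hx, h0, hρ, t, j, htj, hs, rfl⟩
    exact ⟨x, hx, h0, hρ, t, j, htj, h.trans hs, rfl⟩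
  · refine tendsto_order.2 ⟨fun a ha => absurd ha not_lt_zero, fun ε hε => ?_⟩
    obtain ⟨a, ha, hsub⟩ := exists_sublevel_indicator_lt hB hω (half_pos hε)
    obtain ⟨ρ₀, hρ₀, hρsub⟩ := exists_indicator_le_subset hB hω ha
    filter_upwards [mem_nhdsWithin_of_mem_nhds (Iio_mem_nhds hρ₀)] with ρ hρ
    -- A supremum of values below `ε / 2` is at most `ε / 2`, which keeps the final inequality
    -- strict; an empty set has supremum `0`.
    refine lt_of_le_of_lt (csSup_le' ?_) (NNReal.half_lt_self hε.ne')
    rintro _ ⟨x, hx, h0, hxρ, t, j, htj, -, rfl⟩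
    exact (hsub _ (sublevel_invariant hB hχ hμ hx
      (hρsub _ h0 (hxρ.trans (le_of_lt hρ))) t j htj)).le
  · refine tendsto_order.2 ⟨fun a ha => absurd ha not_lt_zero, fun ε hε => ?_⟩
    obtain ⟨a, ha, hsub⟩ := exists_sublevel_indicator_lt hB hω (half_pos hε)
    obtain ⟨T, hT, hTsub⟩ := exists_uniform_time (l := l) hB hχ hμ (hω.isCompact_le ρ)
      (fun x hx => hx.1) ha
    filter_upwards [eventually_ge_atTop T.toNNReal] with s hs
    refine lt_of_le_of_lt (csSup_le' ?_) (NNReal.half_lt_self hε.ne')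
    rintro _ ⟨x, hx, h0, hxρ, t, j, htj, hst, rfl⟩
    have ht := x.isHybridTimeDomain.nonneg _ _ htj
    exact (hsub _ (hTsub x hx ⟨h0, hxρ⟩ t j htj
      ((Real.toNNReal_le_toNNReal_iff (by positivity)).1 (hs.trans hst)))).le
  · intro x hx h0 t j htj
    exact le_csSup (hbdd _ _) ⟨x, hx, h0, le_rfl, t, j, htj, le_rfl, rfl⟩

end SourceSeeking

/-! ### Regularity of the data -/

theorem oscRelativeTo_singleton {P X : Type*} [TopologicalSpace P] [TopologicalSpace X] [T2Space X]
    {f : P → X} (hf : Continuous f) (K : Set P) : OSCRelativeTo (fun p => {f p}) K := by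
  intro z _ zs ss s hmem hz hs
  have h1 : ss = fun i => f (zs i) := funext fun i => (hmem i).2
  rw [h1] at hs
  exact tendsto_nhds_unique hs ((hf.tendsto z).comp hz)

theorem lbRelativeTo_singleton {P X : Type*} [TopologicalSpace P] [PseudoMetricSpace X]
    {f : P → X} (hf : Continuous f) (K : Set P) : LBRelativeTo (fun p => {f p}) K := by
  intro z _
  refine ⟨f ⁻¹' Metric.ball (f z) 1, Metric.isOpen_ball.preimage hf,
    Metric.mem_ball_self one_pos, (Metric.isBounded_ball (x := f z) (r := 1)).subset ?_⟩
  refine iUnion₂_subset fun y hy => ?_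
  rintro _ rfl
  exact hy.1

namespace SourceSeeking

variable {p₀ uStar : Plane} {r : ℝ} {J : Plane → ℝ} {B : ℝ → Plane → ℝ} {χ l : ℝ}

theorem dynamics_isRegular (hB : BarrierAssumption p₀ r J B uStar) (hχ : 0 < χ)
    (hμ : 0 < χ - l) :
    (dynamics p₀ r J B χ l).IsRegular (closure (freeSpace p₀ r)) where
  closed_C := isClosed_flowSet hB hχ
  closed_D := isClosed_jumpSet hB hμ
  proj_C := by
    rintro _ ⟨x, hx, rfl⟩
    exact hx.1
  proj_D := by
    rintro _ ⟨x, hx, rfl⟩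
    exact hx.1
  osc_F := oscRelativeTo_singleton
    (f := fun p : (Plane × ℝ) × Plane => ((-p.2, 0) : Plane × ℝ)) (by fun_prop) _
  lb_F := lbRelativeTo_singleton
    (f := fun p : (Plane × ℝ) × Plane => ((-p.2, 0) : Plane × ℝ)) (by fun_prop) _
  convex_F := fun _ _ ξ => convex_singleton ((-ξ, 0) : Plane × ℝ)
  osc_G := oscRelativeTo_singleton
    (f := fun p : Plane × ℝ => ((p.1, 3 - p.2) : Plane × ℝ)) (by fun_prop) _
  lb_G := lbRelativeTo_singleton
    (f := fun p : Plane × ℝ => ((p.1, 3 - p.2) : Plane × ℝ)) (by fun_prop) _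

/-- The hysteresis thresholds overlap: `(χ - l) Ĵ ≤ χ Ĵ` because `l > 0` and `Ĵ ≥ 0`, so failure of
the flow inequality implies the jump inequality. -/
theorem freeSpace_subset_flowSet_union (hB : BarrierAssumption p₀ r J B uStar) (hl : 0 < l)
    {x : Plane × ℝ} (hx : x ∈ freeSpace p₀ r ×ˢ modes) :
    x ∈ (dynamics p₀ r J B χ l).C ∪ (dynamics p₀ r J B χ l).D := by
  have hcl := subset_closure hx.1
  rcases le_total (Jhat p₀ r J B x.2 x.1) ((χ : EReal) * Jhat p₀ r J B (3 - x.2) x.1) with h | h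
  · exact Or.inl ⟨hcl, hx.2, h⟩
  · refine Or.inr ⟨hcl, hx.2, le_trans ?_ h⟩
    exact mul_le_mul_of_nonneg_right (EReal.coe_le_coe_iff.2 (by linarith))
      (hB.nonneg _ (three_sub_mem_modes hx.2) _)

/-! ### Basin of attraction -/

/-- The arc that switches the mode forever without flowing. -/
def switchingArc (u : Plane) (q : ℝ) : HybridArc (Plane × ℝ) where
  dom := {p | p.1 = 0}
  val _ j := (u, if Even j then q else 3 - q)
  isHybridTimeDomain := by
    refine ⟨fun i => {p | p.2 < i ∧ p.1 ∈ Icc 0 0}, fun i => ⟨i, fun _ => 0, rfl,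
      fun _ _ => le_rfl, rfl⟩, fun i k hik p hp => ⟨lt_of_lt_of_le hp.1 hik, hp.2⟩, ?_⟩
    ext p
    simp only [mem_ofPred_eq, mem_iUnion, Icc_self, mem_singleton_iff]
    exact ⟨fun h => ⟨p.2 + 1, Nat.lt_succ_self _, h⟩, fun ⟨_, _, h⟩ => h⟩
  locallyAC := by
    intro j h
    simp at h

/-- Off `𝒰` both potentials are infinite, so the jump inequality reads `∞ ≤ ∞` in either mode. The
flow condition concerns only the null set `{0}`. -/
theorem switchingArc_isSolution {u : Plane} (hu : u ∈ closure (freeSpace p₀ r))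
    (hu' : u ∉ freeSpace p₀ r) {q : ℝ} (hq : q ∈ modes) :
    ((dynamics p₀ r J B χ l).target (gradJhat p₀ r J B)).IsSolution (switchingArc u q) := by
  have htop : ∀ q, Jhat p₀ r J B q u = ⊤ := fun q =>
    Jhat_of_notMem fun h => hu' (region_subset_freeSpace q h)
  have hm : ∀ j : ℕ, (if Even j then q else 3 - q) ∈ modes := fun j => by
    split_ifs
    exacts [hq, three_sub_mem_modes hq]
  have hD : ∀ t j, (switchingArc u q).val t j ∈ (dynamics p₀ r J B χ l).D := fun t j =>
    ⟨hu, hm j, by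
      change _ * Jhat p₀ r J B _ u ≤ Jhat p₀ r J B _ u
      rw [htop, htop]
      exact le_top⟩
  refine ⟨rfl, Or.inr (hD 0 0), fun j => ?_, fun t j _ _ => ⟨hD t j, ?_⟩⟩
  · have h0 : (switchingArc u q).interval j = {0} := rfl
    rw [h0, Measure.restrict_singleton]
    simp
  · change (u, if Even (j + 1) then q else 3 - q) = (u, 3 - if Even j then q else 3 - q)
    by_cases hj : Even j <;> simp [hj, Nat.even_add_one]

theorem basin_target (hB : BarrierAssumption p₀ r J B uStar) (hχ : 0 < χ) (hl : 0 < l)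
    (hμ : 1 < χ - l) :
    ((dynamics p₀ r J B χ l).target (gradJhat p₀ r J B)).basin ({uStar} ×ˢ modes) =
      freeSpace p₀ r ×ˢ modes := by
  apply Subset.antisymm
  · rintro ⟨u, q⟩ ⟨hCD, hsol⟩
    have huq : u ∈ closure (freeSpace p₀ r) ∧ q ∈ modes := by
      rcases hCD with h | h
      exacts [⟨h.1, h.2.1⟩, ⟨h.1, h.2.1⟩]
    refine ⟨?_, huq.2⟩
    by_contra hu
    change u ∉ freeSpace p₀ r at hu
    have hne : u ≠ uStar := fun h =>
      hu (h ▸ region_subset_freeSpace _ (hB.uStar_mem_region_and huq.2).1)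
    obtain ⟨-, hconv⟩ := hsol (switchingArc u q)
      (switchingArc_isSolution huq.1 hu huq.2) (by simp [switchingArc])
    have hcomplete : (switchingArc u q).IsComplete := by
      intro hbd
      obtain ⟨M, hM⟩ := (Metric.isBounded_iff_subset_closedBall ((0 : ℝ), 0)).1 hbd
      obtain ⟨n, hn⟩ := exists_nat_gt M
      have h1 := hM (show ((0 : ℝ), n) ∈ (switchingArc u q).dom from rfl)
      rw [Metric.mem_closedBall, Prod.dist_eq] at h1
      have h2 := (le_max_right _ _).trans h1
      rw [Nat.dist_eq] at h2
      simp at h2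
      linarith
    -- The first component never moves, so the distance to the target set never falls below `dist u
    -- uStar`.
    obtain ⟨T, hT⟩ := hconv hcomplete (dist u uStar) (dist_pos.2 hne)
    obtain ⟨n, hn⟩ := exists_nat_ge T
    have h1 := hT 0 n rfl (by simpa using hn)
    obtain ⟨y, hy, hlt⟩ := (Metric.infDist_lt_iff
      (show (({uStar} : Set Plane) ×ˢ modes).Nonempty from ⟨(uStar, q), rfl, huq.2⟩)).1 h1
    have hy1 : y.1 = uStar := hy.1
    have h2 : dist u y.1 ≤ dist ((switchingArc u q).val 0 n) y := le_max_left _ _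
    rw [hy1] at h2
    linarith
  · intro x₀ hx₀
    refine ⟨freeSpace_subset_flowSet_union hB hl hx₀, fun x hx h0 => ⟨?_, fun _ => ?_⟩⟩
    · obtain ⟨c, hc⟩ := exists_uniform_bound hB hχ hμ (isCompact_singleton (x := x₀))
        (singleton_subset_iff.2 hx₀)
      refine ((isCompact_sublevel hB c).isBounded.union
        (Bornology.isBounded_singleton (x := x₀))).subset ?_
      rintro _ ⟨t, j, htj, rfl⟩
      rcases hc x hx h0 t j htj with ⟨rfl, rfl⟩ | h
      exacts [Or.inr h0, Or.inl h]
    · intro ε hε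
      obtain ⟨a, ha, hsub⟩ := exists_sublevel_subset hB
        (O := {y | Metric.infDist y ({uStar} ×ˢ modes) < ε})
        (isOpen_lt (Metric.continuous_infDist_pt _) continuous_const)
        (fun y hy => by simpa [Metric.infDist_zero_of_mem hy] using hε)
      obtain ⟨T, -, hT⟩ := exists_uniform_time hB hχ hμ (isCompact_singleton (x := x₀))
        (singleton_subset_iff.2 hx₀) ha
      exact ⟨T, fun t j htj ht => hsub (hT x hx h0 t j htj ht)⟩

theorem target_isUASWithBasin (hB : BarrierAssumption p₀ r J B uStar) (hχ : 0 < χ) (hl : 0 < l)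
    (hμ : 1 < χ - l) :
    ((dynamics p₀ r J B χ l).target (gradJhat p₀ r J B)).IsUASWithBasin
      ({uStar} ×ˢ modes) (freeSpace p₀ r ×ˢ modes) where
  isCompact := isCompact_singleton.prod (Set.toFinite {1, 2}).isCompact
  subset := by
    rintro ⟨u, q⟩ ⟨hu, hq⟩
    obtain rfl : u = uStar := hu
    exact ⟨region_subset_freeSpace _ (hB.uStar_mem_region_and hq).1, hq⟩
  relOpen := by
    refine ⟨freeSpace p₀ r ×ˢ univ, isOpen_freeSpace.prod isOpen_univ, ?_⟩
    ext x
    constructor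
    · intro hx
      exact ⟨⟨hx.1, mem_univ _⟩, freeSpace_subset_flowSet_union hB hl hx⟩
    · rintro ⟨hx, h | h⟩
      exacts [⟨hx.1, h.2.1⟩, ⟨hx.1, h.2.1⟩]
  invariant := fun _ hx h0 _ _ htj => invariant_freeSpace hB hχ hμ hx h0 htj
  bound := fun _ hω => exists_KL_bound hB hχ hμ hω
  basin_eq := basin_target hB hχ hl hμ

end SourceSeeking

theorem mainTheorem10
    (p₀ uStar : SourceSeeking.Plane) (r : ℝ) (hr : 0 < r)
    (J : SourceSeeking.Plane → ℝ) (B : ℝ → SourceSeeking.Plane → ℝ)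
    (hO : {u | u ∈ closure (SourceSeeking.freeSpace p₀ r) ∧
      IsMaxOn J (closure (SourceSeeking.freeSpace p₀ r)) u} = {uStar})
    (χ l : ℝ) (hχ : 1 < χ) (hl : l ∈ Set.Ioo 0 (χ - 1))
    (hB : SourceSeeking.BarrierAssumption p₀ r J B uStar) :
    (SourceSeeking.dynamics p₀ r J B χ l).IsRegular (closure (SourceSeeking.freeSpace p₀ r)) ∧
    ((SourceSeeking.dynamics p₀ r J B χ l).target
        (SourceSeeking.gradJhat p₀ r J B)).IsUASWithBasin
      ({uStar} ×ˢ SourceSeeking.modes)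
      (SourceSeeking.freeSpace p₀ r ×ˢ SourceSeeking.modes) := by
  obtain ⟨hl0, hl1⟩ := hl
  exact ⟨SourceSeeking.dynamics_isRegular hB (by linarith) (by linarith),
    SourceSeeking.target_isUASWithBasin hB (by linarith) hl0 (by linarith)⟩
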